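/- **Setting.** Let $d\ge 1$, $p\in\mathbb N$, $\theta_{inf}<\theta_{sup}$ and $\Theta=[\theta_{inf},\theta_{sup}]^p$. Let $\{K_\theta:\mathbb R^d\to\mathbb R,\ \theta\in\Theta\}$ be a family of stationary covariance functions such that: * for every $t$, $\theta\mapsto K_\theta(t)$ is three times differentiable on $\Theta$, and for all $q\in\{0,\dots,3\}$ and $i_1,\dots,i_q\in\{1,\dots,p\}$ there is $C_{i_1,\dots,i_q}<\infty$ with $\left|\frac{\partial}{\partial\theta_{i_1}}\cdots\frac{\partial}{\partial\theta_{i_q}}K_\theta(t)\right|\le \frac{C_{i_1,\dots,i_q}}{1+|t|^{d+1}}$ for all $\theta\in\Theta$, $t\in\mathbb R^d$, where $|t|$ is the Euclidean norm (derivatives are one-sided on the faces of $\Theta$); * with $\hat K_\theta(f)=(2\pi)^{-d}\int_{\mathbb R^d}K_\theta(t)e^{-\mathrm i f\cdot t}\,dt$, the function $\hat K_\theta$ is integrable and $K_\theta(t)=\int_{\mathbb R^d}\hat K_\theta(f)e^{\mathrm i f\cdot t}\,df$ for all $\theta\in\Theta$, $t\in\mathbb R^d$; and $(f,\theta)\mapsto\hat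 K_\theta(f)$ is real-valued, continuous and positive on $\mathbb R^d\times\Theta$. Let $\mathcal L_X$ be a probability distribution on $\mathbb R^d$ that is symmetric ($-X\sim\mathcal L_X$ if $X\sim \mathcal L_X$), whose support $S_X$ is contained in $[-1,1]^d$ and which has a probability density function that is positive on $S_X$. Let $(v_i)_{i\ge1}$ be a sequence in $\{1,2,\dots\}^d$ with $\{v_i: 1\le i\le N^d\}=\{1,\dots,N\}^d$ for all $N\ge1$, and let $\epsilon\in[0,\frac12)$. For $x=(x_1,\dots,x_n)\in (S_X)^n$ let $R_\theta$ be the $n\times n$ matrix with entries $(R_\theta)_{i,j}=K_\theta\left(v_i-v_j+\epsilon(x_i-x_j)\right)$; it becomes a random matrix when $x$ is replaced by $X=(X_1,\dots,X_n)$, where $(X_i)_{i\ge1}$ are i.i.d. with distribution $\mathcal L_X$. For a square matrix $A$, $\mathrm{diag}(A)$ is the matrix obtained from $A$ by setting all off-diagonal entries to $0$. Let $S_p=\bigcup_{k=0}^3\{1,\dots,p\}^k$ and $S_{nd}=S_p\cup\{-1\}$. For $I=(i_1,\dots,i_k)\in S_p$ put $R_\theta^I=\frac{\partial}{\partial\theta_{i_1}}\cdots\frac{\partial}{\partial\theta_{i_k}}R_\theta$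 (so $R_\theta^{I}=R_\theta$ for $k=0$), and put $R_\theta^{-1}$ for the inverse matrix when $I=-1$. Consider the matrices * $M_{nd}^I=R_\theta^I$ for $I\in S_{nd}$; * $M_{sd}^1=\mathrm{diag}(R_\theta^{-1})^{-1}$; * $M_{bd}^I=\mathrm{diag}\left(R_\theta^{I_1}\cdots R_\theta^{I_m}\right)$ for $I=(I_1,\dots,I_m)\in S_{nd}^m$, $m\ge1$. Let $\mathcal M_\theta$ be the set of all (sequences in $n$ of) products $M_{d_1}^{I_1}\cdots M_{d_k}^{I_k}$, $k\ge1$, of such matrices for which, for each factor with $d_j=bd$, the product matrix inside $\mathrm{diag}$ is symmetric (for all $n$ and all $x\in (S_X)^n$). **Proposition.** 1. For every choice of labels $(d_1,I_1),\dots,(d_k,I_k)$, the singular values of $M_{d_1}^{I_1}\cdots M_{d_k}^{I_k}$ are bounded uniformly in $n$, in $x\in(S_X)^n$ and in those $\theta\in\Theta$ for which the product belongs to $\mathcal M_\theta$. 2. For $\theta\in\Theta$ and $M_{d_1}^{I_1}\cdots M_{d_k}^{I_k}\in\mathcal M_\theta$ let $S_n=\frac1n\mathrm{Tr}\left(M_{d_1}^{I_1}\cdots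 M_{d_k}^{I_k}\right)$, evaluated at $x=X$. Then, for the given family $\{K_\theta\}$ and law $\mathcal L_X$, there is a deterministic $S\in\mathbb R$, depending only on $\epsilon$, $\theta$ and $(d_1,I_1),\dots,(d_k,I_k)$ (not on the enumeration $(v_i)$ nor on the realization of the $X_i$), such that $S_n\to S$ almost surely as $n\to\infty$. Moreover the $S_n$ are square-integrable, $S_n\to S$ in quadratic mean, and $\mathrm{var}(S_n)\to0$ as $n\to\infty$. -/

import Mathlib

open MeasureTheory ProbabilityTheory Filter Topology

noncomputable section

namespace PerturbedGrid

/-- The parameter set `Θ = [a, b]^p`. -/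
def paramSet (p : ℕ) (a b : ℝ) : Set (Fin p → ℝ) :=
  {θ | ∀ i, θ i ∈ Set.Icc a b}

/-- Partial derivative `∂f/∂θ_i` on the cube `[a, b]^p` (one-sided on the faces `θ_i = a` and
`θ_i = b`). -/
def partialDeriv {p : ℕ} (a b : ℝ) (i : Fin p) (f : (Fin p → ℝ) → ℝ) (θ : Fin p → ℝ) : ℝ :=
  derivWithin (fun s : ℝ => f (Function.update θ i s)) (Set.Icc a b) (θ i)

/-- Iterated partial derivative `∂/∂θ_{i_1} ... ∂/∂θ_{i_q} f` for `I = [i_1, ..., i_q]`; for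
`I = []` this is `f`. -/
def iterPartial {p : ℕ} (a b : ℝ) (I : List (Fin p)) (f : (Fin p → ℝ) → ℝ) :
    (Fin p → ℝ) → ℝ :=
  I.foldr (partialDeriv a b) f

/-- `k` is the covariance function `(s, t) ↦ k (s - t)` of a real stationary process on `ℝ^d`. -/
def IsStationaryCovariance {d : ℕ} (k : EuclideanSpace ℝ (Fin d) → ℝ) : Prop :=
  (∀ t, k (-t) = k t) ∧
    ∀ (s : Finset (EuclideanSpace ℝ (Fin d))) (c : EuclideanSpace ℝ (Fin d) → ℝ),
      0 ≤ ∑ t ∈ s, ∑ u ∈ s, c t * c u * k (t - u)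

/-- The Fourier transform `ĥ(f) = (2π)^{-d} ∫ h(t) e^{-i f·t} dt`. -/
def fourierHat {d : ℕ} (h : EuclideanSpace ℝ (Fin d) → ℝ) (f : EuclideanSpace ℝ (Fin d)) : ℂ :=
  (((2 * Real.pi) ^ d)⁻¹ : ℝ) *
    ∫ t : EuclideanSpace ℝ (Fin d), (h t : ℂ) * Complex.exp (-(Complex.I * (inner ℝ f t : ℝ)))

/-- The regularity condition on the parametric model `{K_θ, θ ∈ [a, b]^p}`. -/
structure ModelCondition {d p : ℕ} (a b : ℝ)
    (K : (Fin p → ℝ) → EuclideanSpace ℝ (Fin d) → ℝ) : Prop where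
  /-- Each `K_θ` is a stationary covariance function. -/
  stationary : ∀ θ ∈ paramSet p a b, IsStationaryCovariance (K θ)
  /-- `K_θ(t)` is three times differentiable in `θ`: it and all its partial derivatives of
  order at most two are differentiable on the cube. -/
  differentiable : ∀ I : List (Fin p), I.length ≤ 2 → ∀ t,
    DifferentiableOn ℝ (iterPartial a b I (fun θ => K θ t)) (paramSet p a b)
  /-- Polynomial decay of `K_θ` and of its derivatives up to order three, uniform in `θ`. -/
  decay : ∀ I : List (Fin p), I.length ≤ 3 → ∃ C : ℝ, ∀ θ ∈ paramSet p a b, ∀ t,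
    |iterPartial a b I (fun θ' => K θ' t) θ| ≤ C / (1 + ‖t‖ ^ (d + 1))
  /-- Fourier inversion holds (with an absolutely convergent integral). -/
  integrable_hat : ∀ θ ∈ paramSet p a b, Integrable (fourierHat (K θ))
  inversion : ∀ θ ∈ paramSet p a b, ∀ t, (K θ t : ℂ) =
    ∫ f : EuclideanSpace ℝ (Fin d),
      fourierHat (K θ) f * Complex.exp (Complex.I * (inner ℝ f t : ℝ))
  /-- `(f, θ) ↦ K̂_θ(f)` is continuous on `ℝ^d × Θ`, with positive real values. -/
  continuous_hat : ContinuousOn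
    (fun q : EuclideanSpace ℝ (Fin d) × (Fin p → ℝ) => fourierHat (K q.2) q.1)
    (Set.univ ×ˢ paramSet p a b)
  positive_hat : ∀ θ ∈ paramSet p a b, ∀ f,
    (fourierHat (K θ) f).im = 0 ∧ 0 < (fourierHat (K θ) f).re

/-- `v` (indexed from `0`) is a sequence of points of `(ℕ*)^d` whose first `N^d` terms are exactly
the points of `{1, ..., N}^d`, for every `N ≥ 1`. -/
def IsGridSequence {d : ℕ} (v : ℕ → Fin d → ℕ) : Prop :=
  ∀ N : ℕ, 1 ≤ N → v '' {i | i < N ^ d} = {u | ∀ k, 1 ≤ u k ∧ u k ≤ N}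

/-- `μ` is a symmetric probability distribution on `ℝ^d` whose support is contained in
`[-1, 1]^d` and which has a probability density function that is positive on its support. -/
structure IsPerturbationLaw {d : ℕ} (μ : Measure (EuclideanSpace ℝ (Fin d))) : Prop where
  isProbability : IsProbabilityMeasure μ
  symmetric : μ.map (fun x => -x) = μ
  support_subset : ∀ x ∈ μ.support, ∀ k, |x k| ≤ 1
  density : ∃ g : EuclideanSpace ℝ (Fin d) → ENNReal, Measurable g ∧
    μ = volume.withDensity g ∧ ∀ x ∈ μ.support, 0 < g x

/-- The `i`-th observation point `v_i + ε x_i`. -/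
def obsPoint {d n : ℕ} (v : ℕ → Fin d → ℕ) (ε : ℝ) (x : Fin n → EuclideanSpace ℝ (Fin d))
    (i : Fin n) : EuclideanSpace ℝ (Fin d) :=
  WithLp.toLp 2 (fun k => (v i k : ℝ)) + ε • x i

/-- The covariance matrix `R_θ`, with entries `K_θ(v_i - v_j + ε (x_i - x_j))`. -/
def covMatrix {d p n : ℕ} (K : (Fin p → ℝ) → EuclideanSpace ℝ (Fin d) → ℝ)
    (v : ℕ → Fin d → ℕ) (ε : ℝ) (x : Fin n → EuclideanSpace ℝ (Fin d)) (θ : Fin p → ℝ) :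
    Matrix (Fin n) (Fin n) ℝ :=
  Matrix.of fun i j => K θ (obsPoint v ε x i - obsPoint v ε x j)

/-- `diag A`: all off-diagonal entries of `A` are replaced by `0`. -/
def diagPart {n : ℕ} (A : Matrix (Fin n) (Fin n) ℝ) : Matrix (Fin n) (Fin n) ℝ :=
  Matrix.diagonal fun i => A i i

/-- The index set `S_nd = S_p ∪ {-1}`, where `S_p` is the set of multi-indices of length at most
three with entries in `{1, ..., p}`. -/
inductive NdIndex (p : ℕ) where
  | deriv (I : List (Fin p)) (hI : I.length ≤ 3)
  | inv

/-- The labels `(nd, I)`, `(sd, 1)` and `(bd, I)` of the factors. -/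
inductive FactorLabel (p : ℕ) where
  | nd (I : NdIndex p)
  | sd
  | bd (L : List (NdIndex p))

/-- The matrix `R_θ^I`: an entrywise partial derivative of `R_θ`, or the inverse of `R_θ`. -/
def ndMatrix {d p n : ℕ} (a b : ℝ) (K : (Fin p → ℝ) → EuclideanSpace ℝ (Fin d) → ℝ)
    (v : ℕ → Fin d → ℕ) (ε : ℝ) (x : Fin n → EuclideanSpace ℝ (Fin d)) (θ : Fin p → ℝ) :
    NdIndex p → Matrix (Fin n) (Fin n) ℝ
  | .deriv I _ => Matrix.of fun i j => iterPartial a b I (fun θ' => covMatrix K v ε x θ' i j) θ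
  | .inv => (covMatrix K v ε x θ)⁻¹

/-- The product `R_θ^{I_1} ... R_θ^{I_m}` for `L = [I_1, ..., I_m]`. -/
def ndProduct {d p n : ℕ} (a b : ℝ) (K : (Fin p → ℝ) → EuclideanSpace ℝ (Fin d) → ℝ)
    (v : ℕ → Fin d → ℕ) (ε : ℝ) (x : Fin n → EuclideanSpace ℝ (Fin d)) (θ : Fin p → ℝ)
    (L : List (NdIndex p)) : Matrix (Fin n) (Fin n) ℝ :=
  (L.map (ndMatrix a b K v ε x θ)).prod

/-- The matrices `M_nd^I = R_θ^I`, `M_sd^1 = diag(R_θ⁻¹)⁻¹` and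
`M_bd^I = diag(R_θ^{I_1} ... R_θ^{I_m})`. -/
def factorMatrix {d p n : ℕ} (a b : ℝ) (K : (Fin p → ℝ) → EuclideanSpace ℝ (Fin d) → ℝ)
    (v : ℕ → Fin d → ℕ) (ε : ℝ) (x : Fin n → EuclideanSpace ℝ (Fin d)) (θ : Fin p → ℝ) :
    FactorLabel p → Matrix (Fin n) (Fin n) ℝ
  | .nd I => ndMatrix a b K v ε x θ I
  | .sd => (diagPart (covMatrix K v ε x θ)⁻¹)⁻¹
  | .bd L => diagPart (ndProduct a b K v ε x θ L)

/-- The product `M_{d_1}^{I_1} ... M_{d_K}^{I_K}` described by the list `w` of labels. -/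
def wordMatrix {d p n : ℕ} (a b : ℝ) (K : (Fin p → ℝ) → EuclideanSpace ℝ (Fin d) → ℝ)
    (v : ℕ → Fin d → ℕ) (ε : ℝ) (x : Fin n → EuclideanSpace ℝ (Fin d)) (θ : Fin p → ℝ)
    (w : List (FactorLabel p)) : Matrix (Fin n) (Fin n) ℝ :=
  (w.map (factorMatrix a b K v ε x θ)).prod

/-- The label list `w` describes an element of the class `𝓜_θ`: it is non-empty, and for each of its
factors `diag(R_θ^{I_1} ... R_θ^{I_m})` one has `m ≥ 1` and the matrix `R_θ^{I_1} ... R_θ^{I_m}` is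
symmetric for all `n` and all `x ∈ S^n`. -/
def MemClass {d p : ℕ} (a b : ℝ) (K : (Fin p → ℝ) → EuclideanSpace ℝ (Fin d) → ℝ)
    (v : ℕ → Fin d → ℕ) (ε : ℝ) (S : Set (EuclideanSpace ℝ (Fin d))) (θ : Fin p → ℝ)
    (w : List (FactorLabel p)) : Prop :=
  w ≠ [] ∧ ∀ L : List (NdIndex p), FactorLabel.bd L ∈ w →
    L ≠ [] ∧ ∀ (n : ℕ) (x : Fin n → EuclideanSpace ℝ (Fin d)), (∀ i, x i ∈ S) →
      (ndProduct a b K v ε x θ L).IsSymm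

/-- The normalized trace `(1/n) Tr(M_{d_1}^{I_1} ... M_{d_K}^{I_K})`. -/
def normTrace {d p n : ℕ} (a b : ℝ) (K : (Fin p → ℝ) → EuclideanSpace ℝ (Fin d) → ℝ)
    (v : ℕ → Fin d → ℕ) (ε : ℝ) (x : Fin n → EuclideanSpace ℝ (Fin d)) (θ : Fin p → ℝ)
    (w : List (FactorLabel p)) : ℝ :=
  (1 / (n : ℝ)) * (wordMatrix a b K v ε x θ w).trace

end PerturbedGrid

end

noncomputable section

namespace PerturbedGrid

open scoped Matrix.Norms.L2Operator
open Matrix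

/-! ### Operator-norm bounds read off from quadratic forms and entries. -/

section OperatorNorm

/-! Everything rests on two estimates for the covariance matrices that are uniform in the size, the
perturbation and `θ` (`ModelCondition.exists_isRegular`). The polynomial decay of `K_θ` and its
derivatives, with the separation of the points, bounds the operator norms by Schur's test. The
continuous positive function `K̂_θ` is bounded below on compact sets uniformly in `θ`, so it
dominates a multiple of a bump whose cosine transform gives a diagonally dominant matrix; hence
`R_θ` is uniformly coercive (`ModelCondition.exists_coercive`).

On matrices with these bounds, products, inverses and diagonal parts are bounded in operator norm
and Lipschitz in trace norm, with constants independent of the dimension (`IsStable.wordEval`).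
Boundedness gives the claim on singular values.

For the limit, cut a box of side `k L` into `k ^ d` boxes of side `L` and discard all entries
between different boxes. Words respect block-diagonal structure, so by trace-norm stability the
trace becomes the sum of the block traces up to a constant times the sum of the discarded decay
bounds (`exists_abs_trace_wordEval_sub_sum_le`). Per point, this error is at most a multiple of
`boundaryLoss`, which tends to 0 as `L` grows. By translation invariance the block traces are
i.i.d., and for fixed `L` the strong law applies. Sizes `n` that are not of the form `(k L) ^ d` are
handled because adding points changes the trace at most proportionally to their number.

Thus the normalized trace is asymptotically within `ρ L → 0` of a deterministic `M L` for every `L`;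
this forces `M` to be Cauchy and both to share a limit
(`tendsto_limUnder_of_eventually_abs_sub_le`). Quadratic convergence follows by domination, since
the normalized traces are almost surely bounded by one constant. -/

theorem norm_toLp_sq {ι : Type} [Fintype ι] (x : ι → ℝ) : ‖WithLp.toLp 2 x‖ ^ 2 = x ⬝ᵥ x := by
  rw [EuclideanSpace.norm_sq_eq]
  simp [dotProduct, sq]

variable {ι : Type} [Fintype ι] [DecidableEq ι]

theorem dotProduct_mulVec_self_le (A : Matrix ι ι ℝ) (x : ι → ℝ) :
    (A *ᵥ x) ⬝ᵥ (A *ᵥ x) ≤ ‖A‖ ^ 2 * (x ⬝ᵥ x) := by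
  have h := Matrix.l2_opNorm_mulVec A (WithLp.toLp 2 x)
  rw [← norm_toLp_sq, ← norm_toLp_sq, ← mul_pow]
  exact pow_le_pow_left₀ (norm_nonneg _) h 2

theorem l2_opNorm_le_of_dotProduct (A : Matrix ι ι ℝ) {C : ℝ} (hC : 0 ≤ C)
    (h : ∀ x : ι → ℝ, (A *ᵥ x) ⬝ᵥ (A *ᵥ x) ≤ C ^ 2 * (x ⬝ᵥ x)) : ‖A‖ ≤ C := by
  rw [Matrix.cstar_norm_def]
  refine ContinuousLinearMap.opNorm_le_bound _ hC fun x => ?_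
  refine le_of_sq_le_sq ?_ (by positivity)
  have := h x.ofLp
  rw [← norm_toLp_sq, ← norm_toLp_sq, ← mul_pow] at this
  exact this

theorem abs_apply_le_l2_opNorm (A : Matrix ι ι ℝ) (i j : ι) : |A i j| ≤ ‖A‖ := by
  refine abs_le_of_sq_le_sq ?_ (norm_nonneg _)
  have h := dotProduct_mulVec_self_le A (Pi.single j 1)
  rw [Matrix.mulVec_single_one] at h
  simp only [dotProduct_single, Pi.single_eq_same, mul_one] at h
  refine le_trans ?_ h
  rw [sq]
  exact Finset.single_le_sum (f := fun k => A k j * A k j) (fun k _ => mul_self_nonneg _)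
    (Finset.mem_univ i)

theorem l2_opNorm_diagonal_le {f : ι → ℝ} {C : ℝ} (hC : 0 ≤ C) (h : ∀ i, |f i| ≤ C) :
    ‖(Matrix.diagonal f : Matrix ι ι ℝ)‖ ≤ C := by
  rw [Matrix.l2_opNorm_diagonal]
  exact (pi_norm_le_iff_of_nonneg hC).2 h

theorem l2_opNorm_one_le : ‖(1 : Matrix ι ι ℝ)‖ ≤ 1 := by
  rw [← Matrix.diagonal_one]
  exact l2_opNorm_diagonal_le zero_le_one (by simp)

theorem l2_opNorm_diagonal_diag_le (A : Matrix ι ι ℝ) : ‖Matrix.diagonal A.diag‖ ≤ ‖A‖ :=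
  l2_opNorm_diagonal_le (norm_nonneg _) fun i => abs_apply_le_l2_opNorm A i i

/-- Schur's test. -/
theorem l2_opNorm_le_of_row_col_sum (A : Matrix ι ι ℝ) {C : ℝ} (hC : 0 ≤ C)
    (hrow : ∀ i, ∑ j, |A i j| ≤ C) (hcol : ∀ j, ∑ i, |A i j| ≤ C) : ‖A‖ ≤ C := by
  refine l2_opNorm_le_of_dotProduct A hC fun x => ?_
  have key : ∀ i, (A *ᵥ x) i * (A *ᵥ x) i ≤ C * ∑ j, |A i j| * (x j * x j) := by
    intro i
    rw [← sq]
    -- Cauchy–Schwarz, with one factor `√|A i j|` given to each side.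
    refine (Finset.sum_sq_le_sum_mul_sum_of_sq_le_mul Finset.univ
      (f := fun j => |A i j|) (g := fun j => |A i j| * (x j * x j))
      (fun j _ => abs_nonneg _) (fun j _ => mul_nonneg (abs_nonneg _) (mul_self_nonneg _))
      (fun j _ => ?_)).trans ?_
    · rw [mul_pow, ← sq_abs (A i j)]; exact le_of_eq (by ring)
    · gcongr
      exacts [Finset.sum_nonneg fun j _ => mul_nonneg (abs_nonneg _) (mul_self_nonneg _), hrow i]
  calc (A *ᵥ x) ⬝ᵥ (A *ᵥ x) ≤ ∑ i, C * ∑ j, |A i j| * (x j * x j) :=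
        Finset.sum_le_sum fun i _ => key i
    _ = C * ∑ j, (∑ i, |A i j|) * (x j * x j) := by
        rw [← Finset.mul_sum, Finset.sum_comm]
        simp_rw [Finset.sum_mul]
    _ ≤ C * ∑ j, C * (x j * x j) := by
        gcongr with j _
        exacts [mul_self_nonneg _, hcol j]
    _ = C ^ 2 * (x ⬝ᵥ x) := by
        rw [← Finset.mul_sum]; simp only [dotProduct]; ring

theorem abs_trace_le (A : Matrix ι ι ℝ) : |A.trace| ≤ Fintype.card ι * ‖A‖ := by
  refine (Finset.abs_sum_le_sum_abs _ _).trans ?_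
  refine (Finset.sum_le_card_nsmul _ _ ‖A‖ fun i _ => abs_apply_le_l2_opNorm A i i).trans ?_
  simp

end OperatorNorm

/-! ### The trace norm by duality. -/

section TraceNorm

variable {ι : Type} [Fintype ι] [DecidableEq ι]

/-- The trace norm of `A` is at most `δ`, expressed by duality with the operator norm. -/
def TraceNormLE (A : Matrix ι ι ℝ) (δ : ℝ) : Prop :=
  ∀ B : Matrix ι ι ℝ, |(A * B).trace| ≤ δ * ‖B‖

theorem TraceNormLE.mono {A : Matrix ι ι ℝ} {δ δ' : ℝ} (h : TraceNormLE A δ) (hδ : δ ≤ δ') :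
    TraceNormLE A δ' := fun B => (h B).trans (by gcongr)

theorem TraceNormLE.add {A A' : Matrix ι ι ℝ} {δ δ' : ℝ} (h : TraceNormLE A δ)
    (h' : TraceNormLE A' δ') : TraceNormLE (A + A') (δ + δ') := fun B => by
  rw [add_mul, Matrix.trace_add, add_mul]
  exact (abs_add_le _ _).trans (add_le_add (h B) (h' B))

theorem TraceNormLE.neg {A : Matrix ι ι ℝ} {δ : ℝ} (h : TraceNormLE A δ) :
    TraceNormLE (-A) δ := fun B => by
  rw [neg_mul, Matrix.trace_neg, abs_neg]
  exact h B

/-- Cyclicity of the trace moves `X` and `Y` onto the test matrix. -/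
theorem TraceNormLE.mul_mul {A : Matrix ι ι ℝ} {δ : ℝ} (h : TraceNormLE A δ) (hδ : 0 ≤ δ)
    (X Y : Matrix ι ι ℝ) : TraceNormLE (X * A * Y) (‖X‖ * δ * ‖Y‖) := fun B => by
  have : (X * A * Y * B).trace = (A * (Y * B * X)).trace := by
    rw [mul_assoc, mul_assoc, Matrix.trace_mul_comm, mul_assoc]
  rw [this]
  refine (h _).trans ?_
  calc δ * ‖Y * B * X‖ ≤ δ * (‖Y‖ * ‖B‖ * ‖X‖) := by
        gcongr
        exact (norm_mul_le _ _).trans (by gcongr; exact norm_mul_le _ _)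
    _ = _ := by ring

/-- Taking the diagonal part is self-adjoint for the trace pairing and contracts the operator norm
of the test matrix. -/
theorem TraceNormLE.diagonal_diag {A : Matrix ι ι ℝ} {δ : ℝ} (h : TraceNormLE A δ) (hδ : 0 ≤ δ) :
    TraceNormLE (Matrix.diagonal A.diag) δ := fun B => by
  have : (Matrix.diagonal A.diag * B).trace = (A * Matrix.diagonal B.diag).trace := by
    simp [Matrix.trace, Matrix.diagonal_mul, Matrix.mul_diagonal]
  rw [this]
  refine (h _).trans ?_
  gcongr
  exact l2_opNorm_diagonal_diag_le B

theorem traceNormLE_sum_abs (A : Matrix ι ι ℝ) : TraceNormLE A (∑ i, ∑ j, |A i j|) := fun B => by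
  simp only [Matrix.trace, Matrix.diag_apply, Matrix.mul_apply, Finset.sum_mul]
  refine (Finset.abs_sum_le_sum_abs _ _).trans (Finset.sum_le_sum fun i _ => ?_)
  refine (Finset.abs_sum_le_sum_abs _ _).trans (Finset.sum_le_sum fun j _ => ?_)
  rw [abs_mul]
  gcongr
  exact abs_apply_le_l2_opNorm B j i

theorem TraceNormLE.abs_trace_le {A : Matrix ι ι ℝ} {δ : ℝ} (h : TraceNormLE A δ) (hδ : 0 ≤ δ) :
    |A.trace| ≤ δ := by
  have := h 1
  rw [mul_one] at this
  exact this.trans (mul_le_of_le_one_right hδ l2_opNorm_one_le)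

end TraceNorm

/-! ### Stability of products of factors under trace-norm perturbation. -/

section Words

variable {p : ℕ}

/-- The value of a label `(nd, I)` at a family `R` of matrices (`R []` in the role of `R_θ`). -/
def ndEval {ι : Type} [Fintype ι] [DecidableEq ι] (R : List (Fin p) → Matrix ι ι ℝ) :
    NdIndex p → Matrix ι ι ℝ
  | .deriv I _ => R I
  | .inv => (R [])⁻¹

/-- The value of a factor label at a family `R` of matrices. -/
def factorEval {ι : Type} [Fintype ι] [DecidableEq ι] (R : List (Fin p) → Matrix ι ι ℝ) :
    FactorLabel p → Matrix ι ι ℝ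
  | .nd I => ndEval R I
  | .sd => (Matrix.diagonal ((R [])⁻¹).diag)⁻¹
  | .bd L => Matrix.diagonal ((L.map (ndEval R)).prod).diag

/-- The value of a product of factors at a family `R` of matrices. -/
def wordEval {ι : Type} [Fintype ι] [DecidableEq ι] (R : List (Fin p) → Matrix ι ι ℝ)
    (w : List (FactorLabel p)) : Matrix ι ι ℝ :=
  (w.map (factorEval R)).prod

/-- `R` is uniformly bounded in operator norm and `R []` is uniformly coercive. -/
structure IsRegular {ι : Type} [Fintype ι] [DecidableEq ι] (c C : ℝ)
    (R : List (Fin p) → Matrix ι ι ℝ) : Prop where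
  norm_le : ∀ I : List (Fin p), I.length ≤ 3 → ‖R I‖ ≤ C
  coercive : ∀ x : ι → ℝ, c * (x ⬝ᵥ x) ≤ x ⬝ᵥ (R [] *ᵥ x)

section Coercive

variable {ι : Type} [Fintype ι] [DecidableEq ι]

/-- Cauchy–Schwarz applied to `x ⬝ᵥ A x`; no symmetry of `A` is needed. Invertibility and the bound
on the inverse both come from this. -/
theorem dotProduct_self_le_of_coercive {c : ℝ} (hc : 0 < c) {A : Matrix ι ι ℝ}
    (h : ∀ x : ι → ℝ, c * (x ⬝ᵥ x) ≤ x ⬝ᵥ (A *ᵥ x)) (x : ι → ℝ) :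
    c ^ 2 * (x ⬝ᵥ x) ≤ (A *ᵥ x) ⬝ᵥ (A *ᵥ x) := by
  have h1 := h x
  have h2 : (x ⬝ᵥ (A *ᵥ x)) ^ 2 ≤ (x ⬝ᵥ x) * ((A *ᵥ x) ⬝ᵥ (A *ᵥ x)) := by
    have := Finset.sum_mul_sq_le_sq_mul_sq Finset.univ x (A *ᵥ x)
    simpa [dotProduct, sq] using this
  have h0 : 0 ≤ x ⬝ᵥ x := by rw [← norm_toLp_sq]; positivity
  rcases h0.eq_or_lt with h0 | h0
  · rw [← h0, mul_zero, ← norm_toLp_sq]; positivity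
  · have h3 : (c * (x ⬝ᵥ x)) ^ 2 ≤ (x ⬝ᵥ (A *ᵥ x)) ^ 2 := by gcongr
    have h4 := h3.trans h2
    refine le_of_mul_le_mul_left ?_ h0
    linarith [h4]

theorem isUnit_det_of_coercive {c : ℝ} (hc : 0 < c) {A : Matrix ι ι ℝ}
    (h : ∀ x : ι → ℝ, c * (x ⬝ᵥ x) ≤ x ⬝ᵥ (A *ᵥ x)) : IsUnit A.det := by
  rw [← Matrix.isUnit_iff_isUnit_det, ← Matrix.mulVec_injective_iff_isUnit]
  refine (injective_iff_map_eq_zero (Matrix.mulVecLin A)).2 fun x hx => ?_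
  have hx' : A *ᵥ x = 0 := hx
  have h1 := dotProduct_self_le_of_coercive hc h x
  rw [hx', zero_dotProduct] at h1
  have h0 : 0 ≤ x ⬝ᵥ x := by rw [← norm_toLp_sq]; positivity
  exact dotProduct_self_eq_zero.1 (le_antisymm (by
    by_contra h2
    push Not at h2
    have : 0 < c ^ 2 * (x ⬝ᵥ x) := by positivity
    linarith) h0)

theorem l2_opNorm_inv_le_of_coercive {c : ℝ} (hc : 0 < c) {A : Matrix ι ι ℝ}
    (h : ∀ x : ι → ℝ, c * (x ⬝ᵥ x) ≤ x ⬝ᵥ (A *ᵥ x)) : ‖A⁻¹‖ ≤ c⁻¹ := by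
  refine l2_opNorm_le_of_dotProduct _ (by positivity) fun x => ?_
  have h1 := dotProduct_self_le_of_coercive hc h (A⁻¹ *ᵥ x)
  rw [Matrix.mulVec_mulVec, Matrix.mul_nonsing_inv _ (isUnit_det_of_coercive hc h),
    Matrix.one_mulVec] at h1
  rw [inv_pow, ← div_eq_inv_mul, le_div_iff₀ (by positivity), mul_comm]
  exact h1

/-- With `z = A⁻¹ e_i`, coercivity gives `c |z|² ≤ z_i`, while `1 = |A z|² ≤ C² |z|²`. This keeps
`diag(A⁻¹)` uniformly away from 0. -/
theorem le_inv_apply_of_coercive {c C : ℝ} (hc : 0 < c) {A : Matrix ι ι ℝ}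
    (h : ∀ x : ι → ℝ, c * (x ⬝ᵥ x) ≤ x ⬝ᵥ (A *ᵥ x)) (hA : ‖A‖ ≤ C) (i : ι) :
    c ≤ C ^ 2 * A⁻¹ i i := by
  set z : ι → ℝ := A⁻¹ *ᵥ Pi.single i 1 with hz
  have hAz : A *ᵥ z = Pi.single i 1 := by
    rw [hz, Matrix.mulVec_mulVec, Matrix.mul_nonsing_inv _ (isUnit_det_of_coercive hc h),
      Matrix.one_mulVec]
  have hzi : z i = A⁻¹ i i := by rw [hz, Matrix.mulVec_single_one]; rfl
  have h1 := h z
  have h2 := dotProduct_mulVec_self_le A z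
  rw [hAz] at h1 h2
  simp only [dotProduct_single, Pi.single_eq_same, mul_one] at h1 h2
  have h0 : 0 ≤ z ⬝ᵥ z := by rw [← norm_toLp_sq]; positivity
  have h3 : ‖A‖ ^ 2 * (z ⬝ᵥ z) ≤ C ^ 2 * (z ⬝ᵥ z) := by gcongr
  rw [← hzi]
  nlinarith [mul_le_mul_of_nonneg_left h1 (sq_nonneg C), mul_le_mul_of_nonneg_left (h2.trans h3) hc.le]

theorem inv_diagonal_diag_inv {c C : ℝ} (hc : 0 < c) {A : Matrix ι ι ℝ}
    (h : ∀ x : ι → ℝ, c * (x ⬝ᵥ x) ≤ x ⬝ᵥ (A *ᵥ x)) (hA : ‖A‖ ≤ C) :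
    (Matrix.diagonal (A⁻¹).diag)⁻¹ = Matrix.diagonal (fun i => (A⁻¹ i i)⁻¹) := by
  refine Matrix.inv_eq_right_inv ?_
  rw [Matrix.diagonal_mul_diagonal, ← Matrix.diagonal_one]
  congr 1
  ext i
  have := le_inv_apply_of_coercive hc h hA i
  refine mul_inv_cancel₀ (fun h0 => ?_)
  rw [Matrix.diag_apply] at h0
  rw [h0] at this
  linarith

theorem isUnit_det_diagonal_diag_inv {c C : ℝ} (hc : 0 < c) {A : Matrix ι ι ℝ}
    (h : ∀ x : ι → ℝ, c * (x ⬝ᵥ x) ≤ x ⬝ᵥ (A *ᵥ x)) (hA : ‖A‖ ≤ C) :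
    IsUnit (Matrix.diagonal (A⁻¹).diag).det := by
  rw [Matrix.det_diagonal, isUnit_iff_ne_zero, Finset.prod_ne_zero_iff]
  intro i _ h0
  have := le_inv_apply_of_coercive hc h hA i
  rw [Matrix.diag_apply] at h0
  rw [h0] at this
  linarith

theorem l2_opNorm_inv_diagonal_diag_inv_le {c C : ℝ} (hc : 0 < c) {A : Matrix ι ι ℝ}
    (h : ∀ x : ι → ℝ, c * (x ⬝ᵥ x) ≤ x ⬝ᵥ (A *ᵥ x)) (hA : ‖A‖ ≤ C) :
    ‖(Matrix.diagonal (A⁻¹).diag)⁻¹‖ ≤ C ^ 2 / c := by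
  rw [inv_diagonal_diag_inv hc h hA]
  refine l2_opNorm_diagonal_le (by positivity) fun i => ?_
  have h1 := le_inv_apply_of_coercive hc h hA i
  have hpos : 0 < A⁻¹ i i := by
    by_contra hn
    push Not at hn
    nlinarith [sq_nonneg C]
  rw [abs_of_pos (inv_pos.2 hpos), inv_eq_one_div, div_le_div_iff₀ hpos hc]
  linarith

/-- The resolvent identity, with the difference in the middle as `TraceNormLE.mul_mul` requires. -/
theorem inv_sub_inv_eq {A A' : Matrix ι ι ℝ} (hA : IsUnit A.det) (hA' : IsUnit A'.det) :
    A⁻¹ - A'⁻¹ = A⁻¹ * -(A - A') * A'⁻¹ := by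
  rw [neg_sub, mul_sub, sub_mul, Matrix.nonsing_inv_mul _ hA, mul_assoc,
    Matrix.mul_nonsing_inv _ hA', mul_one, one_mul]

end Coercive

/-- A functional of families of matrices that is bounded in operator norm and Lipschitz in trace
norm on the class `IsRegular c C`. -/
def IsStable (c C : ℝ)
    (F : ∀ {ι : Type} [Fintype ι] [DecidableEq ι], (List (Fin p) → Matrix ι ι ℝ) → Matrix ι ι ℝ) :
    Prop :=
  ∃ B : ℝ, 0 ≤ B ∧ ∀ {ι : Type} [Fintype ι] [DecidableEq ι] (R : List (Fin p) → Matrix ι ι ℝ),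
    IsRegular c C R → ‖F R‖ ≤ B ∧ ∀ R' : List (Fin p) → Matrix ι ι ℝ, IsRegular c C R' →
      ∀ δ : ℝ, 0 ≤ δ → (∀ I : List (Fin p), I.length ≤ 3 → TraceNormLE (R I - R' I) δ) →
        TraceNormLE (F R - F R') (B * δ)

variable {c C : ℝ}

theorem IsStable.one : IsStable (p := p) c C fun {_} [_] [_] _ => 1 := by
  refine ⟨1, zero_le_one, fun R _ => ⟨l2_opNorm_one_le, fun R' _ δ hδ _ B => ?_⟩⟩
  simp only [sub_self, zero_mul, Matrix.trace_zero, abs_zero]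
  positivity

/-- Telescoping: each difference is multiplied by a factor bounded in operator norm, so the
trace-norm bound survives. -/
theorem IsStable.mul
    {F G : ∀ {ι : Type} [Fintype ι] [DecidableEq ι],
      (List (Fin p) → Matrix ι ι ℝ) → Matrix ι ι ℝ}
    (hF : IsStable c C F) (hG : IsStable c C G) :
    IsStable c C fun {_} [_] [_] R => F R * G R := by
  obtain ⟨B, hB, hF⟩ := hF
  obtain ⟨D, hD, hG⟩ := hG
  -- One constant must serve both claims: `B * D` bounds the norm and `2 * (B * D)` is a Lipschitz
  -- constant.
  refine ⟨2 * (B * D) + B * D, by positivity, fun {ι} _ _ R hR =>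
    ⟨?_, fun R' hR' δ hδ h => ?_⟩⟩
  · refine (norm_mul_le _ _).trans ?_
    have := mul_le_mul (hF R hR).1 (hG R hR).1 (norm_nonneg _) hB
    linarith [mul_nonneg hB hD]
  · have h1 := ((hF R hR).2 R' hR' δ hδ h).mul_mul (by positivity) 1 (G R)
    have h2 := ((hG R hR).2 R' hR' δ hδ h).mul_mul (by positivity) (F R') 1
    have h3 := h1.add h2
    rw [show 1 * (F R - F R') * G R + F R' * (G R - G R') * 1 = F R * G R - F R' * G R' by
      noncomm_ring] at h3
    refine h3.mono ?_
    have e1 : ‖(1 : Matrix ι ι ℝ)‖ * (B * δ) * ‖G R‖ ≤ 1 * (B * δ) * D := by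
      gcongr
      exacts [l2_opNorm_one_le, (hG R hR).1]
    have e2 : ‖F R'‖ * (D * δ) * ‖(1 : Matrix ι ι ℝ)‖ ≤ B * (D * δ) * 1 := by
      gcongr
      exacts [(hF R' hR').1, l2_opNorm_one_le]
    nlinarith [mul_nonneg (mul_nonneg hB hD) hδ]

theorem IsStable.diagonal_diag
    {F : ∀ {ι : Type} [Fintype ι] [DecidableEq ι],
      (List (Fin p) → Matrix ι ι ℝ) → Matrix ι ι ℝ}
    (hF : IsStable c C F) : IsStable c C fun {_} [_] [_] R => Matrix.diagonal (F R).diag := by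
  obtain ⟨B, hB, hF⟩ := hF
  refine ⟨B, hB, fun R hR => ⟨(l2_opNorm_diagonal_diag_le _).trans (hF R hR).1,
    fun R' hR' δ hδ h => ?_⟩⟩
  have e : Matrix.diagonal (F R).diag - Matrix.diagonal (F R').diag
      = Matrix.diagonal (F R - F R').diag := by
    rw [Matrix.diagonal_sub]; rfl
  rw [e]
  exact ((hF R hR).2 R' hR' δ hδ h).diagonal_diag (by positivity)

theorem IsStable.inv
    {F : ∀ {ι : Type} [Fintype ι] [DecidableEq ι],
      (List (Fin p) → Matrix ι ι ℝ) → Matrix ι ι ℝ}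
    (hF : IsStable c C F) {D : ℝ} (hD : 0 ≤ D)
    (hunit : ∀ {ι : Type} [Fintype ι] [DecidableEq ι] (R : List (Fin p) → Matrix ι ι ℝ),
      IsRegular c C R → IsUnit (F R).det ∧ ‖(F R)⁻¹‖ ≤ D) :
    IsStable c C fun {_} [_] [_] R => (F R)⁻¹ := by
  obtain ⟨B, hB, hF⟩ := hF
  refine ⟨D + D * B * D, by positivity, fun R hR => ⟨?_, fun R' hR' δ hδ h => ?_⟩⟩
  · have := (hunit R hR).2
    have h2 : 0 ≤ D * B * D := by positivity
    linarith
  · rw [inv_sub_inv_eq (hunit R hR).1 (hunit R' hR').1]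
    refine (((hF R hR).2 R' hR' δ hδ h).neg.mul_mul (by positivity) _ _).mono ?_
    have e1 : ‖(F R)⁻¹‖ * (B * δ) * ‖(F R')⁻¹‖ ≤ D * (B * δ) * D := by
      gcongr
      exacts [(hunit R hR).2, (hunit R' hR').2]
    nlinarith [mul_nonneg hD hδ]

theorem IsStable.list_prod {α : Type} (l : List α)
    (F : α → ∀ {ι : Type} [Fintype ι] [DecidableEq ι],
      (List (Fin p) → Matrix ι ι ℝ) → Matrix ι ι ℝ)
    (hF : ∀ s, IsStable c C (F s)) :
    IsStable c C fun {_} [_] [_] R => (l.map fun s => F s R).prod := by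
  induction l with
  | nil => simpa using IsStable.one
  | cons s l ih => simpa using (hF s).mul ih

theorem IsStable.ndEval (hc : 0 < c) (hC : 0 ≤ C) (I : NdIndex p) :
    IsStable c C fun {_} [_] [_] R => ndEval R I := by
  cases I with
  | deriv I hI =>
    -- `C` bounds the norm and 1 is the Lipschitz constant of an evaluation.
    refine ⟨C + 1, by positivity, fun R hR => ⟨?_, fun R' hR' δ hδ h => ?_⟩⟩
    · have := hR.norm_le I hI
      simp only [PerturbedGrid.ndEval]; linarith
    · exact (h I hI).mono (by nlinarith)
  | inv =>
    have h0 : IsStable (p := p) c C fun {_} [_] [_] R => R [] := by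
      refine ⟨C + 1, by positivity, fun R hR => ⟨?_, fun R' hR' δ hδ h => ?_⟩⟩
      · have := hR.norm_le [] (by simp)
        linarith
      · exact (h [] (by simp)).mono (by nlinarith)
    exact h0.inv (D := c⁻¹) (by positivity) fun R hR =>
      ⟨isUnit_det_of_coercive hc hR.coercive, l2_opNorm_inv_le_of_coercive hc hR.coercive⟩

theorem IsStable.factorEval (hc : 0 < c) (hC : 0 ≤ C) (s : FactorLabel p) :
    IsStable c C fun {_} [_] [_] R => factorEval R s := by
  cases s with
  | nd I => exact IsStable.ndEval hc hC I
  | sd =>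
    exact (IsStable.ndEval hc hC NdIndex.inv).diagonal_diag.inv (D := C ^ 2 / c) (by positivity)
      fun R hR =>
        ⟨isUnit_det_diagonal_diag_inv hc hR.coercive (hR.norm_le [] (by simp)),
          l2_opNorm_inv_diagonal_diag_inv_le hc hR.coercive (hR.norm_le [] (by simp))⟩
  | bd L =>
    exact (IsStable.list_prod L (fun I {_} [_] [_] R => PerturbedGrid.ndEval R I)
      fun I => IsStable.ndEval hc hC I).diagonal_diag

theorem IsStable.wordEval (hc : 0 < c) (hC : 0 ≤ C) (w : List (FactorLabel p)) :
    IsStable c C fun {_} [_] [_] R => wordEval R w :=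
  IsStable.list_prod w (fun s {_} [_] [_] R => PerturbedGrid.factorEval R s)
    fun s => IsStable.factorEval hc hC s

end Words

end PerturbedGrid

namespace PerturbedGrid

open scoped Matrix.Norms.L2Operator
open Matrix

/-! ### Relabelling the index set. -/

section Reindex

variable {p : ℕ} {ι κ : Type} [Fintype ι] [DecidableEq ι] [Fintype κ] [DecidableEq κ]

theorem list_prod_submatrix {α : Type} (l : List α) (F : α → Matrix ι ι ℝ) (e : κ ≃ ι) :
    (l.map fun s => (F s).submatrix e e).prod = ((l.map F).prod).submatrix e e := by
  induction l with
  | nil => simp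
  | cons s l ih => simp [ih, Matrix.submatrix_mul_equiv]

theorem diagonal_diag_submatrix (A : Matrix ι ι ℝ) (e : κ ≃ ι) :
    Matrix.diagonal (A.submatrix e e).diag = (Matrix.diagonal A.diag).submatrix e e := by
  rw [Matrix.submatrix_diagonal_equiv]; rfl

theorem ndEval_submatrix (R : List (Fin p) → Matrix ι ι ℝ) (e : κ ≃ ι) (I : NdIndex p) :
    ndEval (fun I => (R I).submatrix e e) I = (ndEval R I).submatrix e e := by
  cases I with
  | deriv I hI => rfl
  | inv => exact Matrix.inv_submatrix_equiv (R []) e e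

theorem factorEval_submatrix (R : List (Fin p) → Matrix ι ι ℝ) (e : κ ≃ ι) (s : FactorLabel p) :
    factorEval (fun I => (R I).submatrix e e) s = (factorEval R s).submatrix e e := by
  cases s with
  | nd I => exact ndEval_submatrix R e I
  | sd =>
    simp only [factorEval]
    rw [Matrix.inv_submatrix_equiv, diagonal_diag_submatrix, Matrix.inv_submatrix_equiv]
  | bd L =>
    simp only [factorEval]
    rw [← diagonal_diag_submatrix, ← list_prod_submatrix, funext (ndEval_submatrix R e)]

theorem wordEval_submatrix (R : List (Fin p) → Matrix ι ι ℝ) (e : κ ≃ ι)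
    (w : List (FactorLabel p)) :
    wordEval (fun I => (R I).submatrix e e) w = (wordEval R w).submatrix e e := by
  simp only [wordEval]
  rw [← list_prod_submatrix, funext (factorEval_submatrix R e)]

theorem trace_submatrix_equiv (A : Matrix ι ι ℝ) (e : κ ≃ ι) :
    (A.submatrix e e).trace = A.trace :=
  e.sum_comp fun i => A i i

theorem IsRegular.submatrix_equiv {c C : ℝ} (hC : 0 ≤ C) {R : List (Fin p) → Matrix ι ι ℝ}
    (hR : IsRegular c C R) (e : κ ≃ ι) : IsRegular c C fun I => (R I).submatrix e e where
  norm_le I hI := by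
    refine l2_opNorm_le_of_dotProduct _ hC fun x => ?_
    rw [Matrix.submatrix_mulVec_equiv, comp_equiv_dotProduct_comp_equiv,
      ← comp_equiv_dotProduct_comp_equiv x x e.symm]
    refine (dotProduct_mulVec_self_le _ _).trans ?_
    exact mul_le_mul_of_nonneg_right (pow_le_pow_left₀ (norm_nonneg _) (hR.norm_le I hI) 2)
      (Finset.sum_nonneg fun j _ => mul_self_nonneg _)
  coercive x := by
    rw [Matrix.submatrix_mulVec_equiv, ← comp_equiv_dotProduct_comp_equiv x x e.symm,
      ← comp_equiv_dotProduct_comp_equiv x _ e.symm]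
    have : ((R [] *ᵥ (x ∘ e.symm)) ∘ e) ∘ e.symm = R [] *ᵥ (x ∘ e.symm) := by
      ext i
      simp
    rw [this]
    exact hR.coercive (x ∘ e.symm)

end Reindex

/-! ### Words of block-diagonal families. -/

section Blocks

variable {p : ℕ} {β : Type} [Fintype β] [DecidableEq β] {ι : β → Type} [∀ b, Fintype (ι b)]
  [∀ b, DecidableEq (ι b)]

theorem list_prod_blockDiagonal' {α : Type} (l : List α) (F : α → ∀ b, Matrix (ι b) (ι b) ℝ) :
    (l.map fun s => Matrix.blockDiagonal' (F s)).prod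
      = Matrix.blockDiagonal' fun b => (l.map fun s => F s b).prod := by
  induction l with
  | nil =>
    simp only [List.map_nil, List.prod_nil]
    exact Matrix.blockDiagonal'_one.symm
  | cons s l ih => simp [ih, ← Matrix.blockDiagonal'_mul]

theorem inv_blockDiagonal' (M : ∀ b, Matrix (ι b) (ι b) ℝ) (h : ∀ b, IsUnit (M b).det) :
    (Matrix.blockDiagonal' M)⁻¹ = Matrix.blockDiagonal' fun b => (M b)⁻¹ := by
  refine Matrix.inv_eq_right_inv ?_
  rw [← Matrix.blockDiagonal'_mul, ← Matrix.blockDiagonal'_one]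
  exact congrArg _ (funext fun b => Matrix.mul_nonsing_inv _ (h b))

theorem diagonal_diag_blockDiagonal' (M : ∀ b, Matrix (ι b) (ι b) ℝ) :
    Matrix.diagonal (Matrix.blockDiagonal' M).diag
      = Matrix.blockDiagonal' fun b => Matrix.diagonal (M b).diag := by
  rw [Matrix.blockDiagonal'_diagonal]
  congr 1
  ext ⟨b, i⟩
  simp [Matrix.blockDiagonal'_apply_eq]

theorem blockDiagonal'_mulVec (M : ∀ b, Matrix (ι b) (ι b) ℝ) (x : (Σ b, ι b) → ℝ) (b : β)
    (i : ι b) : (Matrix.blockDiagonal' M *ᵥ x) ⟨b, i⟩ = (M b *ᵥ fun j => x ⟨b, j⟩) i := by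
  simp only [Matrix.mulVec, dotProduct]
  rw [Fintype.sum_sigma, Finset.sum_eq_single b]
  · simp [Matrix.blockDiagonal'_apply_eq]
  · intro b' _ hb
    exact Finset.sum_eq_zero fun j _ => by
      rw [Matrix.blockDiagonal'_apply_ne _ _ _ (Ne.symm hb), zero_mul]
  · simp

variable {c C : ℝ} {R : ∀ b, List (Fin p) → Matrix (ι b) (ι b) ℝ}

theorem IsRegular.blockDiagonal' (hC : 0 ≤ C) (h : ∀ b, IsRegular c C (R b)) :
    IsRegular c C fun I => Matrix.blockDiagonal' fun b => R b I where
  norm_le I hI := by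
    refine l2_opNorm_le_of_dotProduct _ hC fun x => ?_
    simp only [dotProduct, Fintype.sum_sigma, blockDiagonal'_mulVec, Finset.mul_sum]
    rw [← Finset.sum_congr rfl fun b _ => Finset.mul_sum _ _ _]
    refine Finset.sum_le_sum fun b _ => ?_
    refine (dotProduct_mulVec_self_le (R b I) fun j => x ⟨b, j⟩).trans ?_
    have h0 : 0 ≤ (fun j => x ⟨b, j⟩) ⬝ᵥ fun j => x ⟨b, j⟩ :=
      Finset.sum_nonneg fun j _ => mul_self_nonneg _
    have := (h b).norm_le I hI
    exact mul_le_mul_of_nonneg_right (pow_le_pow_left₀ (norm_nonneg _) this 2) h0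
  coercive x := by
    simp only [dotProduct, Fintype.sum_sigma, blockDiagonal'_mulVec, Finset.mul_sum]
    rw [← Finset.sum_congr rfl fun b _ => Finset.mul_sum _ _ _]
    exact Finset.sum_le_sum fun b _ => (h b).coercive fun j => x ⟨b, j⟩

theorem ndEval_blockDiagonal' (hc : 0 < c) (h : ∀ b, IsRegular c C (R b)) (I : NdIndex p) :
    ndEval (fun I => Matrix.blockDiagonal' fun b => R b I) I
      = Matrix.blockDiagonal' fun b => ndEval (R b) I := by
  cases I with
  | deriv I hI => rfl
  | inv => exact inv_blockDiagonal' _ fun b => isUnit_det_of_coercive hc (h b).coercive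

theorem factorEval_blockDiagonal' (hc : 0 < c) (h : ∀ b, IsRegular c C (R b))
    (s : FactorLabel p) :
    factorEval (fun I => Matrix.blockDiagonal' fun b => R b I) s
      = Matrix.blockDiagonal' fun b => factorEval (R b) s := by
  cases s with
  | nd I => exact ndEval_blockDiagonal' hc h I
  | sd =>
    simp only [factorEval]
    rw [inv_blockDiagonal' _ fun b => isUnit_det_of_coercive hc (h b).coercive,
      diagonal_diag_blockDiagonal', inv_blockDiagonal' _ fun b =>
        isUnit_det_diagonal_diag_inv hc (h b).coercive ((h b).norm_le [] (by simp))]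
  | bd L =>
    simp only [factorEval]
    rw [← diagonal_diag_blockDiagonal', ← list_prod_blockDiagonal',
      funext (ndEval_blockDiagonal' hc h)]

/-- Products, inverses and diagonal parts act blockwise; regularity supplies the invertibility of
every block that must be inverted. -/
theorem wordEval_blockDiagonal' (hc : 0 < c) (h : ∀ b, IsRegular c C (R b))
    (w : List (FactorLabel p)) :
    wordEval (fun I => Matrix.blockDiagonal' fun b => R b I) w
      = Matrix.blockDiagonal' fun b => wordEval (R b) w := by
  simp only [wordEval]
  rw [← list_prod_blockDiagonal', funext (factorEval_blockDiagonal' hc h)]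

end Blocks

/-! ### Discarding the entries between blocks. -/

section Decoupling

variable {p : ℕ} {c C : ℝ}

/-- Replacing a regular family by its diagonal blocks changes the trace of a product of factors by
at most a constant times the sum of the entries outside the blocks. -/
theorem exists_abs_trace_wordEval_sub_sum_le (hc : 0 < c) (hC : 0 ≤ C)
    (w : List (FactorLabel p)) : ∃ B : ℝ, 0 ≤ B ∧ ∀ {ι β : Type} [Fintype ι] [DecidableEq ι]
      [Fintype β] [DecidableEq β] (π : ι → β) (R : List (Fin p) → Matrix ι ι ℝ),
      IsRegular c C R → (∀ b, IsRegular c C fun I =>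
        (R I).submatrix (Subtype.val : {i // π i = b} → ι) Subtype.val) →
      ∀ δ : ℝ, 0 ≤ δ → (∀ I : List (Fin p), I.length ≤ 3 →
        ∑ i, ∑ j, (if π i = π j then 0 else |R I i j|) ≤ δ) →
      |(wordEval R w).trace - ∑ b, (wordEval (fun I =>
        (R I).submatrix (Subtype.val : {i // π i = b} → ι) Subtype.val) w).trace| ≤ B * δ := by
  obtain ⟨B, hB, H⟩ := IsStable.wordEval hc hC w
  refine ⟨B, hB, fun {ι β} _ _ _ _ π R hR hRb δ hδ h => ?_⟩
  let e : (Σ b, {i // π i = b}) ≃ ι := Equiv.sigmaFiberEquiv π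
  have hblock := IsRegular.blockDiagonal' hC hRb
  -- Stability compares `R`, regrouped along the fibres of `π`, with its block-diagonal part; their
  -- difference consists of the cross entries.
  have h1 := ((H _ (IsRegular.submatrix_equiv hC hR e)).2 _ hblock δ hδ fun I hI => ?_).abs_trace_le
    (by positivity)
  · beta_reduce at h1
    rw [Matrix.trace_sub, wordEval_submatrix, trace_submatrix_equiv,
      wordEval_blockDiagonal' hc hRb, Matrix.trace_blockDiagonal'] at h1
    exact h1
  · refine (traceNormLE_sum_abs _).mono (le_trans (le_of_eq ?_) (h I hI))
    rw [← e.sum_comp]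
    refine Finset.sum_congr rfl fun i _ => ?_
    rw [← e.sum_comp]
    refine Finset.sum_congr rfl fun j _ => ?_
    obtain ⟨b, i, hi⟩ := i
    obtain ⟨b', j, hj⟩ := j
    subst hi hj
    by_cases hij : π i = π j
    -- Both indices must be written in literally the same fibre before the block entry can be read
    -- off.
    · have : (⟨π j, ⟨j, rfl⟩⟩ : Σ b, {i // π i = b}) = ⟨π i, ⟨j, hij.symm⟩⟩ := by
        rw [Sigma.mk.injEq]
        exact ⟨hij.symm, by congr 1 <;> simp [hij]⟩
      rw [this, Matrix.sub_apply, Matrix.blockDiagonal'_apply_eq]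
      simp [e, hij]
    · rw [Matrix.sub_apply, Matrix.blockDiagonal'_apply_ne _ _ _ hij]
      simp [e, hij]

end Decoupling

end PerturbedGrid

namespace PerturbedGrid

open scoped Matrix.Norms.L2Operator
open Matrix

/-! ### Measurability of traces of words. -/

section Measurability

variable {p : ℕ} {α : Type*} [MeasurableSpace α] {ι : Type} [Fintype ι] [DecidableEq ι]

/-- All entries of the random matrix `A` are measurable. -/
def EntryMeasurable (A : α → Matrix ι ι ℝ) : Prop := ∀ i j, Measurable fun ω => A ω i j

theorem EntryMeasurable.mul {A B : α → Matrix ι ι ℝ} (hA : EntryMeasurable A)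
    (hB : EntryMeasurable B) : EntryMeasurable fun ω => A ω * B ω := fun i j => by
  simp only [Matrix.mul_apply]
  exact Finset.measurable_sum _ fun k _ => (hA i k).mul (hB k j)

theorem EntryMeasurable.det {A : α → Matrix ι ι ℝ} (hA : EntryMeasurable A) :
    Measurable fun ω => (A ω).det := by
  simp only [Matrix.det_apply]
  refine Finset.measurable_sum _ fun σ _ => Measurable.const_smul ?_ _
  exact Finset.measurable_prod _ fun i _ => hA _ _

/-- Cramer's rule expresses the entries through determinants; division by 0 is harmless, so
invertibility is not required. -/
theorem EntryMeasurable.inv {A : α → Matrix ι ι ℝ} (hA : EntryMeasurable A) :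
    EntryMeasurable fun ω => (A ω)⁻¹ := fun i j => by
  simp only [Matrix.inv_def, Matrix.smul_apply, Ring.inverse_eq_inv', smul_eq_mul,
    Matrix.adjugate_apply]
  refine hA.det.inv.mul (EntryMeasurable.det fun k l => ?_)
  by_cases hk : k = j
  · subst hk; simp
  · simp only [Matrix.updateRow_ne hk]
    exact hA k l

theorem EntryMeasurable.diagonal_diag {A : α → Matrix ι ι ℝ} (hA : EntryMeasurable A) :
    EntryMeasurable fun ω => Matrix.diagonal (A ω).diag := fun i j => by
  by_cases h : i = j
  · subst h; simpa using hA i i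
  · simp [Matrix.diagonal_apply_ne _ h]

theorem EntryMeasurable.list_prod {β : Type} (l : List β) (F : β → α → Matrix ι ι ℝ)
    (h : ∀ s, EntryMeasurable (F s)) : EntryMeasurable fun ω => (l.map fun s => F s ω).prod := by
  induction l with
  | nil => exact fun i j => by simp
  | cons s l ih => simpa using (h s).mul ih

variable {R : α → List (Fin p) → Matrix ι ι ℝ}

theorem EntryMeasurable.ndEval
    (h : ∀ I : List (Fin p), I.length ≤ 3 → EntryMeasurable fun ω => R ω I) (I : NdIndex p) :
    EntryMeasurable fun ω => ndEval (R ω) I := by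
  cases I with
  | deriv I hI => exact h I hI
  | inv => exact (h [] (by simp)).inv

theorem EntryMeasurable.factorEval
    (h : ∀ I : List (Fin p), I.length ≤ 3 → EntryMeasurable fun ω => R ω I) (s : FactorLabel p) :
    EntryMeasurable fun ω => factorEval (R ω) s := by
  cases s with
  | nd I => exact EntryMeasurable.ndEval h I
  | sd => exact (h [] (by simp)).inv.diagonal_diag.inv
  | bd L => exact (EntryMeasurable.list_prod L _ fun I => EntryMeasurable.ndEval h I).diagonal_diag

theorem measurable_trace_wordEval
    (h : ∀ I : List (Fin p), I.length ≤ 3 → EntryMeasurable fun ω => R ω I)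
    (w : List (FactorLabel p)) : Measurable fun ω => (wordEval (R ω) w).trace :=
  Finset.measurable_sum _ fun i _ =>
    EntryMeasurable.list_prod w _ (fun s => EntryMeasurable.factorEval h s) i i

end Measurability

/-! ### Summability of the decay profile over `ℤ^d`. -/

section Lattice

/-- The decay profile `(1 + (s ‖w‖)^{d+1})⁻¹` on `ℤ^d`. -/
def decayProfile (d : ℕ) (s : ℝ) (w : Fin d → ℤ) : ℝ := 1 / (1 + (s * ‖w‖) ^ (d + 1))

variable {d : ℕ} {s : ℝ}

theorem decayProfile_pos (hs : 0 < s) (w : Fin d → ℤ) : 0 < decayProfile d s w := by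
  unfold decayProfile; positivity

theorem decayProfile_neg (w : Fin d → ℤ) : decayProfile d s (-w) = decayProfile d s w := by
  unfold decayProfile; rw [norm_neg]

/-- The integer points form a lattice of rank `d`, and the exponent `d + 1` exceeds that rank. -/
theorem summable_norm_pow_inv_int : Summable fun w : Fin d → ℤ => ((‖w‖ : ℝ) ^ (d + 1))⁻¹ := by
  let b := Pi.basisFun ℝ (Fin d)
  let L : Submodule ℤ (Fin d → ℝ) := Submodule.span ℤ (Set.range b)
  have hfin : Module.finrank ℤ L = d := by
    rw [ZLattice.rank ℝ L]; simp
  have h := ZLattice.summable_norm_pow_inv (L := L) (d + 1) (by omega)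
  let f : (Fin d → ℤ) → L := fun w => ⟨fun k => (w k : ℝ), by
    have : (fun k => (w k : ℝ)) = ∑ k, w k • b k := by
      ext k
      simp [b, Finset.sum_apply, Pi.single_apply]
    rw [this]
    exact Submodule.sum_mem _ fun k _ => Submodule.smul_mem _ _ (Submodule.subset_span ⟨k, rfl⟩)⟩
  have hf : Function.Injective f := fun w w' hw => by
    ext k
    have : (w k : ℝ) = (w' k : ℝ) := congrFun (congrArg Subtype.val hw) k
    exact_mod_cast this
  refine (h.comp_injective hf).congr fun w => ?_
  have : ‖f w‖ = ‖w‖ := by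
    refine le_antisymm ((pi_norm_le_iff_of_nonneg (norm_nonneg _)).2 fun k => ?_)
      ((pi_norm_le_iff_of_nonneg (norm_nonneg _)).2 fun k => ?_)
    · exact (Int.norm_cast_real (w k)).trans_le (norm_le_pi_norm w k)
    · exact (Int.norm_cast_real (w k)).symm.trans_le
        (norm_le_pi_norm (f w : Fin d → ℝ) k)
  rw [Function.comp_apply, this, inv_pow]

theorem summable_decayProfile (hs : 0 < s) : Summable (decayProfile d s) := by
  refine Summable.of_norm_bounded_eventually (g := fun w => (s ^ (d + 1))⁻¹ * ((‖w‖ : ℝ) ^ (d + 1))⁻¹) (summable_norm_pow_inv_int.mul_left _) ?_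
  -- At the origin the comparison function takes the default value `0⁻¹` and need not dominate.
  have : ∀ᶠ w : Fin d → ℤ in cofinite, w ≠ 0 := by
    simp [Filter.eventually_cofinite]
  filter_upwards [this] with w hw
  rw [Real.norm_of_nonneg (decayProfile_pos hs w).le]
  have : 0 < ‖w‖ := norm_pos_iff.2 hw
  unfold decayProfile
  rw [← mul_inv, ← mul_pow, ← one_div]
  exact one_div_le_one_div_of_le (by positivity) (by linarith)

theorem sum_decayProfile_sub_le (hs : 0 < s) {ι : Type} [Fintype ι] {u : ι → Fin d → ℤ}
    (hu : Function.Injective u) (z : Fin d → ℤ) :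
    ∑ j, decayProfile d s (z - u j) ≤ ∑' w, decayProfile d s w := by
  have hinj : Function.Injective fun j => z - u j := fun i j h => hu (sub_right_injective h)
  rw [← tsum_fintype (L := .unconditional _)]
  exact ((summable_decayProfile hs).comp_injective hinj).tsum_le_tsum_of_inj _ hinj
    (fun _ _ => (decayProfile_pos hs _).le) (fun _ => le_rfl) (summable_decayProfile hs)

theorem sum_decayProfile_sub_le' (hs : 0 < s) {ι : Type} [Fintype ι] {u : ι → Fin d → ℤ}
    (hu : Function.Injective u) (z : Fin d → ℤ) :
    ∑ j, decayProfile d s (u j - z) ≤ ∑' w, decayProfile d s w := by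
  refine (le_of_eq (Finset.sum_congr rfl fun j _ => ?_)).trans (sum_decayProfile_sub_le hs hu z)
  rw [← decayProfile_neg, neg_sub]

end Lattice

/-! ### Separation of the perturbed points. -/

section Grid

variable {d : ℕ} {ι : Type}

/-- The point `u_i + ε x_i` for a grid position `u_i ∈ ℤ^d`. -/
def gridPoint (ε : ℝ) (u : ι → Fin d → ℤ) (x : ι → EuclideanSpace ℝ (Fin d)) (i : ι) :
    EuclideanSpace ℝ (Fin d) :=
  WithLp.toLp 2 (fun k => (u i k : ℝ)) + ε • x i

/-- In a coordinate realizing the sup norm, distinct grid positions differ by an integer of modulus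
at least 1, and the perturbation changes this difference by at most `2 ε`. -/
theorem le_norm_gridPoint_sub {ε : ℝ} (hε : ε ∈ Set.Ico (0 : ℝ) (1 / 2)) (u : ι → Fin d → ℤ)
    {x : ι → EuclideanSpace ℝ (Fin d)} (hx : ∀ i k, |x i k| ≤ 1) (i j : ι) :
    (1 - 2 * ε) * ‖u i - u j‖ ≤ ‖gridPoint ε u x i - gridPoint ε u x j‖ := by
  have h0 : 0 ≤ 1 - 2 * ε := by linarith [hε.2]
  rcases eq_or_ne (u i - u j) 0 with h | h
  · rw [h]; simp
  obtain ⟨k, hk⟩ : ∃ k, ‖(u i - u j) k‖ = ‖u i - u j‖ := by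
    by_contra! hne
    exact lt_irrefl _ ((pi_norm_lt_iff (norm_pos_iff.2 h)).2 fun k =>
      lt_of_le_of_ne (norm_le_pi_norm _ k) (hne k))
  have h1 : 1 ≤ ‖u i - u j‖ := by
    rw [← hk, Int.norm_eq_abs]
    have : (u i - u j) k ≠ 0 := by
      intro h2
      rw [h2, norm_zero] at hk
      exact h (norm_eq_zero.1 hk.symm)
    exact_mod_cast Int.one_le_abs this
  refine le_trans ?_ (PiLp.norm_apply_le _ k)
  simp only [gridPoint, PiLp.sub_apply, PiLp.add_apply, PiLp.smul_apply, smul_eq_mul,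
    Real.norm_eq_abs]
  rw [← hk, Int.norm_eq_abs] at h1 ⊢
  have h2 : |x i k - x j k| ≤ 2 := (abs_sub _ _).trans (by linarith [hx i k, hx j k])
  have h3 : |((u i - u j) k : ℝ)| - ε * |x i k - x j k| ≤
      |(u i k : ℝ) + ε * x i k - ((u j k : ℝ) + ε * x j k)| := by
    have := abs_sub_abs_le_abs_sub (((u i - u j) k : ℤ) : ℝ) (-(ε * (x i k - x j k)))
    rw [abs_neg, abs_mul, abs_of_nonneg hε.1] at this
    refine this.trans (le_of_eq ?_)
    congr 1
    push_cast [Pi.sub_apply]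
    ring
  nlinarith [hε.1, mul_le_mul_of_nonneg_left h2 hε.1]

end Grid

end PerturbedGrid

namespace PerturbedGrid

open scoped Matrix.Norms.L2Operator
open Matrix

/-! ### Cosine transforms and spectral domination. -/

section CosTransform

variable {d : ℕ}

/-- The cosine transform `t ↦ ∫ h(f) cos (f·t) df`. -/
def cosTransform (h : EuclideanSpace ℝ (Fin d) → ℝ) (t : EuclideanSpace ℝ (Fin d)) : ℝ :=
  ∫ f, h f * Real.cos (inner ℝ f t)

theorem integrable_mul_cos {h : EuclideanSpace ℝ (Fin d) → ℝ} (hh : Integrable h)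
    (t : EuclideanSpace ℝ (Fin d)) : Integrable fun f => h f * Real.cos (inner ℝ f t) := by
  refine hh.mul_bdd (c := 1) (Continuous.aestronglyMeasurable (by fun_prop)) ?_
  exact Eventually.of_forall fun f => Real.abs_cos_le_one _

theorem sum_mul_cos_sub {ι : Type} [Fintype ι] (c a : ι → ℝ) :
    ∑ i, ∑ j, c i * c j * Real.cos (a i - a j)
      = (∑ i, c i * Real.cos (a i)) ^ 2 + (∑ i, c i * Real.sin (a i)) ^ 2 := by
  rw [sq, sq, Finset.sum_mul_sum, Finset.sum_mul_sum, ← Finset.sum_add_distrib]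
  refine Finset.sum_congr rfl fun i _ => ?_
  rw [← Finset.sum_add_distrib]
  refine Finset.sum_congr rfl fun j _ => ?_
  rw [Real.cos_sub]; ring

theorem sum_mul_cosTransform {ι : Type} [Fintype ι] {h : EuclideanSpace ℝ (Fin d) → ℝ}
    (hh : Integrable h) (c : ι → ℝ) (y : ι → EuclideanSpace ℝ (Fin d)) :
    ∑ i, ∑ j, c i * c j * cosTransform h (y i - y j)
      = ∫ f, h f * ∑ i, ∑ j, c i * c j * Real.cos (inner ℝ f (y i - y j)) := by
  have hint : ∀ i j, Integrable fun f => c i * c j * (h f * Real.cos (inner ℝ f (y i - y j))) :=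
    fun i j => (integrable_mul_cos hh _).const_mul _
  simp only [cosTransform, ← integral_const_mul]
  rw [← Finset.sum_congr rfl fun i _ => integral_finsetSum _ fun j _ => hint i j]
  rw [← integral_finsetSum _ fun i _ => integrable_finsetSum _ fun j _ => hint i j]
  refine integral_congr_ae (Eventually.of_forall fun f => ?_)
  simp only [Finset.mul_sum]
  refine Finset.sum_congr rfl fun i _ => Finset.sum_congr rfl fun j _ => ?_
  ring

/-- The quadratic form integrates the spectral density against a sum of two squares
(`sum_mul_cos_sub`), so a pointwise order of densities gives an order of forms. -/
theorem sum_mul_cosTransform_mono {ι : Type} [Fintype ι] {q h : EuclideanSpace ℝ (Fin d) → ℝ}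
    (hq : Integrable q) (hh : Integrable h) (hle : ∀ f, q f ≤ h f) (c : ι → ℝ)
    (y : ι → EuclideanSpace ℝ (Fin d)) :
    ∑ i, ∑ j, c i * c j * cosTransform q (y i - y j)
      ≤ ∑ i, ∑ j, c i * c j * cosTransform h (y i - y j) := by
  have hint : ∀ {g : EuclideanSpace ℝ (Fin d) → ℝ}, Integrable g → Integrable fun f =>
      g f * ∑ i, ∑ j, c i * c j * Real.cos (inner ℝ f (y i - y j)) := by
    intro g hg
    have : Integrable fun f => ∑ i, ∑ j, c i * c j * (g f * Real.cos (inner ℝ f (y i - y j))) :=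
      integrable_finsetSum _ fun i _ => integrable_finsetSum _ fun j _ =>
        (integrable_mul_cos hg _).const_mul _
    refine this.congr (Eventually.of_forall fun f => ?_)
    simp only [Finset.mul_sum]
    exact Finset.sum_congr rfl fun i _ => Finset.sum_congr rfl fun j _ => by ring
  rw [sum_mul_cosTransform hq, sum_mul_cosTransform hh]
  refine integral_mono (hint hq) (hint hh) fun f => mul_le_mul_of_nonneg_right (hle f) ?_
  simp only [inner_sub_right]
  rw [sum_mul_cos_sub c fun i => inner ℝ f (y i)]
  positivity

theorem cosTransform_const_mul (δ : ℝ) (q : EuclideanSpace ℝ (Fin d) → ℝ)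
    (t : EuclideanSpace ℝ (Fin d)) :
    cosTransform (fun f => δ * q f) t = δ * cosTransform q t := by
  simp only [cosTransform, mul_assoc, integral_const_mul]

theorem cosTransform_comp_inv_smul (q : EuclideanSpace ℝ (Fin d) → ℝ) {M : ℝ} (hM : 0 < M)
    (t : EuclideanSpace ℝ (Fin d)) :
    cosTransform (fun f => q (M⁻¹ • f)) t = M ^ d * cosTransform q (M • t) := by
  have := Measure.integral_comp_inv_smul_of_nonneg (μ := (volume : Measure (EuclideanSpace ℝ (Fin d))))
    (fun f => q f * Real.cos (inner ℝ f (M • t))) hM.le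
  rw [finrank_euclideanSpace_fin, smul_eq_mul] at this
  rw [cosTransform, cosTransform, ← this]
  refine integral_congr_ae (Eventually.of_forall fun f => ?_)
  simp only [inner_smul_left, inner_smul_right, conj_trivial]
  rw [mul_inv_cancel_left₀ hM.ne']

theorem cosTransform_eq_re_fourier {q : EuclideanSpace ℝ (Fin d) → ℝ} (hq : Integrable q)
    (t : EuclideanSpace ℝ (Fin d)) :
    cosTransform q t
      = (FourierTransform.fourier (fun f => (q f : ℂ)) ((2 * Real.pi)⁻¹ • t)).re := by
  rw [Real.fourier_eq', ← RCLike.re_eq_complex_re, ← integral_re]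
  · refine integral_congr_ae (Eventually.of_forall fun f => ?_)
    have : ((-2 * Real.pi * inner ℝ f ((2 * Real.pi)⁻¹ • t) : ℝ) : ℂ) = ((-inner ℝ f t : ℝ) : ℂ) := by
      congr 1
      rw [inner_smul_right]
      field_simp
    simp only [smul_eq_mul]
    rw [this, RCLike.re_eq_complex_re, Complex.re_mul_ofReal, Complex.exp_ofReal_mul_I_re,
      Real.cos_neg, mul_comm]
  · refine (hq.ofReal (𝕜 := ℂ)).bdd_mul (c := 1) (Continuous.aestronglyMeasurable (by fun_prop)) ?_
    refine Eventually.of_forall fun f => ?_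
    rw [Complex.norm_exp_ofReal_mul_I]

/-- A nonnegative, bounded, compactly supported function whose cosine transform is positive at the
origin and relatively small away from it. -/
theorem exists_concentrated_cosTransform {η : ℝ} (hη : 0 < η) :
    ∃ q : EuclideanSpace ℝ (Fin d) → ℝ, ∃ r : ℝ, Integrable q ∧ (∀ f, q f ≤ 1) ∧
      (∀ f, r < ‖f‖ → q f = 0) ∧ 0 < cosTransform q 0 ∧
      ∀ t, t ≠ 0 → |cosTransform q t| ≤ η * cosTransform q 0 / ‖t‖ ^ (d + 1) := by
  let φ : ContDiffBump (0 : EuclideanSpace ℝ (Fin d)) := ⟨1, 2, one_pos, one_lt_two⟩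
  have hφint : Integrable (φ : EuclideanSpace ℝ (Fin d) → ℝ) :=
    φ.continuous.integrable_of_hasCompactSupport φ.hasCompactSupport
  have hcs : HasCompactSupport fun f => ((φ f : ℝ) : ℂ) :=
    φ.hasCompactSupport.comp_left (g := fun r : ℝ => (r : ℂ)) Complex.ofReal_zero
  let Φ : SchwartzMap (EuclideanSpace ℝ (Fin d)) ℂ :=
    hcs.toSchwartzMap (Complex.ofRealCLM.contDiff.comp φ.contDiff)
  obtain ⟨D, hD, hdecay⟩ := (FourierTransform.fourier Φ).decay (d + 1) 0
  have hpos : 0 < cosTransform φ 0 := by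
    simp only [cosTransform, inner_zero_right, Real.cos_zero, mul_one]
    exact φ.integral_pos
  set I := cosTransform φ 0
  -- Dilating the bump by `M` multiplies its transform by `M ^ d` everywhere but evaluates it at `M
  -- • t`, where Schwartz decay of order `d + 1` gains `M ^ (d + 1)`. As `1 ≤ M`, a condition linear
  -- in `M` suffices.
  obtain ⟨M, hM1, hM⟩ : ∃ M : ℝ, 1 ≤ M ∧ D * (2 * Real.pi) ^ (d + 1) ≤ η * I * M := by
    refine ⟨max 1 (D * (2 * Real.pi) ^ (d + 1) / (η * I)), le_max_left _ _, ?_⟩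
    rw [← div_le_iff₀' (by positivity)]
    exact le_max_right _ _
  have hM0 : 0 < M := by linarith
  refine ⟨fun f => φ (M⁻¹ • f), M * 2, ?_, fun f => φ.le_one, fun f hf => ?_, ?_, fun t ht => ?_⟩
  · exact (integrable_comp_smul_iff volume _ (by positivity)).2 hφint
  · refine φ.zero_of_le_dist ?_
    rw [dist_zero_right, norm_smul, norm_inv, Real.norm_of_nonneg hM0.le, ← div_eq_inv_mul,
      le_div_iff₀ hM0]
    change 2 * M ≤ ‖f‖
    linarith
  · rw [cosTransform_comp_inv_smul _ hM0, smul_zero]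
    positivity
  · rw [cosTransform_comp_inv_smul _ hM0, cosTransform_comp_inv_smul _ hM0, smul_zero, abs_mul,
      abs_of_pos (by positivity : 0 < M ^ d), cosTransform_eq_re_fourier hφint]
    have h1 := hdecay ((2 * Real.pi)⁻¹ • M • t)
    rw [norm_iteratedFDeriv_zero, norm_smul, norm_smul, norm_inv, Real.norm_of_nonneg hM0.le,
      Real.norm_of_nonneg (by positivity : 0 ≤ 2 * Real.pi)] at h1
    have h2 : |(FourierTransform.fourier (fun f => ((φ f : ℝ) : ℂ)) ((2 * Real.pi)⁻¹ • M • t)).re|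
        ≤ ‖(FourierTransform.fourier Φ) ((2 * Real.pi)⁻¹ • M • t)‖ := Complex.abs_re_le_norm _
    set F := ‖(FourierTransform.fourier Φ) ((2 * Real.pi)⁻¹ • M • t)‖
    have ht0 : 0 < ‖t‖ := norm_pos_iff.2 ht
    refine (mul_le_mul_of_nonneg_left h2 (by positivity)).trans ?_
    have h3 : (M * ‖t‖) ^ (d + 1) * F ≤ D * (2 * Real.pi) ^ (d + 1) := by
      rw [mul_pow, inv_pow, ← div_eq_inv_mul, div_mul_eq_mul_div, div_le_iff₀ (by positivity)] at h1
      exact h1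
    have h4 : M * ‖t‖ ^ (d + 1) * F ≤ η * I * M := by
      refine le_trans ?_ (h3.trans hM)
      rw [mul_pow]
      gcongr
      exact le_self_pow₀ hM1 (by omega)
    have h5 : ‖t‖ ^ (d + 1) * F ≤ η * I :=
      le_of_mul_le_mul_left (by linarith) hM0
    rw [le_div_iff₀ (by positivity)]
    calc M ^ d * F * ‖t‖ ^ (d + 1) = M ^ d * (‖t‖ ^ (d + 1) * F) := by ring
      _ ≤ M ^ d * (η * I) := by gcongr
      _ = _ := by ring

end CosTransform

/-! ### Uniform coercivity of the covariance matrices. -/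

section Coercivity

/-- The off-diagonal part has operator norm at most `c` by Schur's test, leaving `2 c - c` from the
diagonal. -/
theorem coercive_of_diagonally_dominant {ι : Type} [Fintype ι] [DecidableEq ι]
    {A : Matrix ι ι ℝ} {c : ℝ} (hc : 0 ≤ c) (hdiag : ∀ i, A i i = 2 * c)
    (hrow : ∀ i, ∑ j, (if i = j then 0 else |A i j|) ≤ c)
    (hcol : ∀ j, ∑ i, (if i = j then 0 else |A i j|) ≤ c) (x : ι → ℝ) :
    c * (x ⬝ᵥ x) ≤ x ⬝ᵥ (A *ᵥ x) := by
  let N : Matrix ι ι ℝ := Matrix.of fun i j => if i = j then 0 else A i j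
  have hAN : A = (2 * c) • (1 : Matrix ι ι ℝ) + N := by
    ext i j
    by_cases h : i = j
    · subst h; simp [N, hdiag]
    · simp [N, h]
  have hN : ‖N‖ ≤ c := by
    refine l2_opNorm_le_of_row_col_sum N hc (fun i => ?_) fun j => ?_
    · refine le_trans (le_of_eq (Finset.sum_congr rfl fun j _ => ?_)) (hrow i)
      by_cases h : i = j <;> simp [N, h]
    · refine le_trans (le_of_eq (Finset.sum_congr rfl fun i _ => ?_)) (hcol j)
      by_cases h : i = j <;> simp [N, h]
  have h0 : 0 ≤ x ⬝ᵥ x := Finset.sum_nonneg fun j _ => mul_self_nonneg _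
  have h1 : |x ⬝ᵥ (N *ᵥ x)| ≤ c * (x ⬝ᵥ x) := by
    refine abs_le_of_sq_le_sq ?_ (by positivity)
    have h2 : (x ⬝ᵥ (N *ᵥ x)) ^ 2 ≤ (x ⬝ᵥ x) * ((N *ᵥ x) ⬝ᵥ (N *ᵥ x)) := by
      have := Finset.sum_mul_sq_le_sq_mul_sq Finset.univ x (N *ᵥ x)
      simpa [dotProduct, sq] using this
    have h3 := dotProduct_mulVec_self_le N x
    have h4 : ‖N‖ ^ 2 * (x ⬝ᵥ x) ≤ c ^ 2 * (x ⬝ᵥ x) := by gcongr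
    nlinarith [mul_le_mul_of_nonneg_left (h3.trans h4) h0]
  rw [hAN, Matrix.add_mulVec, Matrix.smul_mulVec, Matrix.one_mulVec, dotProduct_add,
    dotProduct_smul, smul_eq_mul]
  linarith [(abs_le.1 h1).1]

theorem dotProduct_mulVec_of {ι : Type} [Fintype ι] (k : ι → ι → ℝ) (x : ι → ℝ) :
    x ⬝ᵥ (Matrix.of k *ᵥ x) = ∑ i, ∑ j, x i * x j * k i j := by
  simp only [dotProduct, Matrix.mulVec, Matrix.of_apply, Finset.mul_sum]
  exact Finset.sum_congr rfl fun i _ => Finset.sum_congr rfl fun j _ => by ring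

variable {d p : ℕ} {a b : ℝ} {K : (Fin p → ℝ) → EuclideanSpace ℝ (Fin d) → ℝ}

theorem isCompact_paramSet : IsCompact (paramSet p a b) := by
  have : paramSet p a b = Set.pi Set.univ fun _ => Set.Icc a b := by
    ext θ; simp only [paramSet, Set.mem_pi, Set.mem_ofPred_eq, Set.mem_univ, true_imp_iff]
  rw [this]
  exact isCompact_univ_pi fun _ => isCompact_Icc

theorem ModelCondition.eq_cosTransform (hK : ModelCondition a b K) {θ : Fin p → ℝ}
    (hθ : θ ∈ paramSet p a b) (t : EuclideanSpace ℝ (Fin d)) :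
    K θ t = cosTransform (fun f => (fourierHat (K θ) f).re) t := by
  have hint : Integrable fun f : EuclideanSpace ℝ (Fin d) =>
      fourierHat (K θ) f * Complex.exp (Complex.I * (inner ℝ f t : ℝ)) := by
    refine (hK.integrable_hat θ hθ).mul_bdd (c := 1)
      (Continuous.aestronglyMeasurable (by fun_prop)) ?_
    refine Eventually.of_forall fun f => ?_
    rw [mul_comm, Complex.norm_exp_ofReal_mul_I]
  have h := congrArg Complex.re (hK.inversion θ hθ t)
  rw [Complex.ofReal_re, ← RCLike.re_eq_complex_re, ← integral_re hint] at h
  rw [h]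
  refine integral_congr_ae (Eventually.of_forall fun f => ?_)
  simp only [RCLike.re_eq_complex_re]
  rw [Complex.mul_re, (hK.positive_hat θ hθ f).1, mul_comm Complex.I, Complex.exp_ofReal_mul_I_re]
  ring

/-- Compactness gives `δ > 0` with `δ q ≤ K̂_θ` for all `θ`, where `q` is a compactly supported
function with concentrated transform. Spectral domination then reduces the claim to the matrix of
`cosTransform q`, which is diagonally dominant because the points are separated. -/
theorem ModelCondition.exists_coercive (hK : ModelCondition a b K) {s : ℝ}
    (hs : 0 < s) :
    ∃ c : ℝ, 0 < c ∧ ∀ θ ∈ paramSet p a b, ∀ {ι : Type} [Fintype ι] [DecidableEq ι]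
      (u : ι → Fin d → ℤ) (y : ι → EuclideanSpace ℝ (Fin d)), Function.Injective u →
      (∀ i j, s * ‖u i - u j‖ ≤ ‖y i - y j‖) → ∀ x : ι → ℝ,
      c * (x ⬝ᵥ x) ≤ x ⬝ᵥ (Matrix.of (fun i j => K θ (y i - y j)) *ᵥ x) := by
  set A : ℝ := ∑' w : Fin d → ℤ, decayProfile d s w
  have hA : 0 ≤ A := tsum_nonneg fun w => (decayProfile_pos hs w).le
  -- Chosen so that `1 + P ≤ B * P` when `P ≥ s ^ (d + 1)`, which turns the bound `1 / P` into a
  -- decay profile.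
  set B : ℝ := 1 + (s ^ (d + 1))⁻¹
  have hB : 0 < B := by positivity
  -- This `η` makes the off-diagonal row sums at most half the diagonal entry; `A + 1` replaces `A`
  -- to keep the denominator positive.
  obtain ⟨q, r, hqint, hq1, hqr, hq0, hqt⟩ := exists_concentrated_cosTransform (d := d)
    (η := 1 / (2 * ((A + 1) * B))) (by positivity)
  obtain ⟨δ, hδ, hδle⟩ : ∃ δ : ℝ, 0 < δ ∧ ∀ θ ∈ paramSet p a b,
      ∀ f : EuclideanSpace ℝ (Fin d), ‖f‖ ≤ r → δ ≤ (fourierHat (K θ) f).re := by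
    have hcomp : IsCompact (Metric.closedBall (0 : EuclideanSpace ℝ (Fin d)) r ×ˢ
        paramSet p a b) := (isCompact_closedBall _ _).prod isCompact_paramSet
    -- Emptiness is possible here, as neither the sign of `r` nor `a ≤ b` is known.
    rcases (Metric.closedBall (0 : EuclideanSpace ℝ (Fin d)) r ×ˢ
        paramSet p a b).eq_empty_or_nonempty with he | hne
    · refine ⟨1, one_pos, fun θ hθ f hf => ?_⟩
      have : (f, θ) ∈ (∅ : Set (EuclideanSpace ℝ (Fin d) × (Fin p → ℝ))) := by
        rw [← he]; exact ⟨by simpa using hf, hθ⟩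
      exact this.elim
    · obtain ⟨⟨f₀, θ₀⟩, h₀, hmin⟩ := hcomp.exists_isMinOn hne
        (Complex.continuous_re.comp_continuousOn (hK.continuous_hat.mono
          (Set.prod_mono (Set.subset_univ _) le_rfl)))
      exact ⟨_, (hK.positive_hat θ₀ h₀.2 f₀).2, fun θ hθ f hf =>
        hmin (a := (f, θ)) ⟨by simpa using hf, hθ⟩⟩
  refine ⟨δ * (cosTransform q 0 / 2), by positivity, fun θ hθ {ι} _ _ u y hu hy x => ?_⟩
  have hh : Integrable fun f => (fourierHat (K θ) f).re := (hK.integrable_hat θ hθ).re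
  have hle : ∀ f, δ * q f ≤ (fourierHat (K θ) f).re := fun f => by
    rcases le_or_gt ‖f‖ r with hf | hf
    · exact (mul_le_of_le_one_right hδ.le (hq1 f)).trans (hδle θ hθ f hf)
    · rw [hqr f hf, mul_zero]
      exact (hK.positive_hat θ hθ f).2.le
  have hmono := sum_mul_cosTransform_mono (hqint.const_mul δ) hh hle x y
  simp only [cosTransform_const_mul, ← hK.eq_cosTransform hθ] at hmono
  rw [dotProduct_mulVec_of]
  refine le_trans ?_ hmono
  have hoff : ∀ i j, (if i = j then 0 else |cosTransform q (y i - y j)|)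
      ≤ cosTransform q 0 / (2 * (A + 1)) * decayProfile d s (u i - u j) := fun i j => by
    split_ifs with hij
    · have := decayProfile_pos hs (u i - u j)
      positivity
    · have hw : 1 ≤ ‖u i - u j‖ := by
        by_contra! hlt
        refine hij (hu ?_)
        ext k
        have h1 := (norm_le_pi_norm (u i - u j) k).trans_lt hlt
        rw [Int.norm_eq_abs] at h1
        have h2 : |(u i - u j) k| < 1 := by exact_mod_cast h1
        have h3 := Int.abs_lt_one_iff.1 h2
        exact sub_eq_zero.1 h3
      have hpos : 0 < s * ‖u i - u j‖ := by positivity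
      have hy0 : y i - y j ≠ 0 := norm_pos_iff.1 (hpos.trans_le (hy i j))
      have hsw : s ^ (d + 1) ≤ (s * ‖u i - u j‖) ^ (d + 1) :=
        pow_le_pow_left₀ hs.le (le_mul_of_one_le_right hs.le hw) _
      have hy1 : (s * ‖u i - u j‖) ^ (d + 1) ≤ ‖y i - y j‖ ^ (d + 1) :=
        pow_le_pow_left₀ hpos.le (hy i j) _
      refine (hqt _ hy0).trans ?_
      unfold decayProfile
      set P := (s * ‖u i - u j‖) ^ (d + 1)
      have hP : 0 < P := by positivity
      have hBP : 1 + P ≤ B * P := by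
        have : 1 ≤ (s ^ (d + 1))⁻¹ * P := by
          rw [← div_eq_inv_mul, le_div_iff₀ (by positivity), one_mul]; exact hsw
        simp only [B]; linarith
      calc 1 / (2 * ((A + 1) * B)) * cosTransform q 0 / ‖y i - y j‖ ^ (d + 1)
          ≤ 1 / (2 * ((A + 1) * B)) * cosTransform q 0 / P := by gcongr
        _ = cosTransform q 0 / (2 * (A + 1)) * (1 / (B * P)) := by field_simp
        _ ≤ cosTransform q 0 / (2 * (A + 1)) * (1 / (1 + P)) := by gcongr
  have hsum : cosTransform q 0 / (2 * (A + 1)) * A ≤ cosTransform q 0 / 2 := by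
    rw [div_mul_eq_mul_div, div_le_div_iff₀ (by positivity) two_pos]
    nlinarith
  have hdom := coercive_of_diagonally_dominant (A := Matrix.of fun i j => cosTransform q (y i - y j))
    (c := cosTransform q 0 / 2) (by positivity) (fun i => by simp; ring)
    (fun i => (Finset.sum_le_sum fun j _ => hoff i j).trans (by
      rw [← Finset.mul_sum]
      exact (mul_le_mul_of_nonneg_left (sum_decayProfile_sub_le hs hu _) (by positivity)).trans hsum))
    (fun j => (Finset.sum_le_sum fun i _ => hoff i j).trans (by
      rw [← Finset.mul_sum]
      exact (mul_le_mul_of_nonneg_left (sum_decayProfile_sub_le' hs hu _)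
        (by positivity)).trans hsum)) x
  rw [dotProduct_mulVec_of] at hdom
  calc δ * (cosTransform q 0 / 2) * (x ⬝ᵥ x)
      ≤ δ * ∑ i, ∑ j, x i * x j * cosTransform q (y i - y j) := by
        rw [mul_assoc]; gcongr
    _ = _ := by
        simp only [Finset.mul_sum]
        exact Finset.sum_congr rfl fun i _ => Finset.sum_congr rfl fun j _ => by ring

end Coercivity

end PerturbedGrid

namespace PerturbedGrid

open scoped Matrix.Norms.L2Operator
open Matrix

/-! ### Covariance matrices as regular families. -/

section Covariance

variable {d p : ℕ} {a b : ℝ} {K : (Fin p → ℝ) → EuclideanSpace ℝ (Fin d) → ℝ}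

/-- There are finitely many multi-indices of length at most three, so one constant serves all. -/
theorem ModelCondition.exists_decay (hK : ModelCondition a b K) :
    ∃ C : ℝ, 0 ≤ C ∧ ∀ I : List (Fin p), I.length ≤ 3 → ∀ θ ∈ paramSet p a b, ∀ t,
      |iterPartial a b I (fun θ' => K θ' t) θ| ≤ C / (1 + ‖t‖ ^ (d + 1)) := by
  choose! C hC using hK.decay
  obtain ⟨D, hD⟩ := ((List.finite_length_le (Fin p) 3).image C).bddAbove
  refine ⟨max D 0, le_max_right _ _, fun I hI θ hθ t => (hC I hI θ hθ t).trans ?_⟩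
  gcongr
  exact (hD ⟨I, hI, rfl⟩).trans (le_max_left _ _)

variable {ι κ : Type}

/-- The derivatives of the covariance matrix at the points `u_i + ε x_i`. -/
def covFamily (a b : ℝ) (K : (Fin p → ℝ) → EuclideanSpace ℝ (Fin d) → ℝ) (ε : ℝ)
    (θ : Fin p → ℝ) (u : ι → Fin d → ℤ) (x : ι → EuclideanSpace ℝ (Fin d)) :
    List (Fin p) → Matrix ι ι ℝ := fun I => Matrix.of fun i j =>
  iterPartial a b I (fun θ' => K θ' (gridPoint ε u x i - gridPoint ε u x j)) θ

theorem covFamily_add_const (ε : ℝ) (θ : Fin p → ℝ) (u : ι → Fin d → ℤ)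
    (x : ι → EuclideanSpace ℝ (Fin d)) (z : Fin d → ℤ) :
    covFamily a b K ε θ (fun i => u i + z) x = covFamily a b K ε θ u x := by
  have : ∀ i j, gridPoint ε (fun i => u i + z) x i - gridPoint ε (fun i => u i + z) x j
      = gridPoint ε u x i - gridPoint ε u x j := fun i j => by
    ext k
    simp [gridPoint]
    ring
  funext I
  ext i j
  simp only [covFamily, this]

theorem abs_covFamily_le {C : ℝ} (hC0 : 0 ≤ C)
    (hC : ∀ I : List (Fin p), I.length ≤ 3 → ∀ θ ∈ paramSet p a b, ∀ t,
      |iterPartial a b I (fun θ' => K θ' t) θ| ≤ C / (1 + ‖t‖ ^ (d + 1)))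
    {ε : ℝ} (hε : ε ∈ Set.Ico (0 : ℝ) (1 / 2)) {θ : Fin p → ℝ} (hθ : θ ∈ paramSet p a b)
    (u : ι → Fin d → ℤ) {x : ι → EuclideanSpace ℝ (Fin d)} (hx : ∀ i k, |x i k| ≤ 1)
    {I : List (Fin p)} (hI : I.length ≤ 3) (i j : ι) :
    |covFamily a b K ε θ u x I i j| ≤ C * decayProfile d (1 - 2 * ε) (u i - u j) := by
  refine (hC I hI θ hθ _).trans ?_
  have h0 : 0 ≤ 1 - 2 * ε := by linarith [hε.2]
  rw [decayProfile, mul_one_div]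
  have := le_norm_gridPoint_sub hε u hx i j
  gcongr

/-- Uniform boundedness and coercivity of the covariance matrices. -/
theorem ModelCondition.exists_isRegular (hK : ModelCondition a b K) {ε : ℝ}
    (hε : ε ∈ Set.Ico (0 : ℝ) (1 / 2)) :
    ∃ c C : ℝ, 0 < c ∧ 0 ≤ C ∧ ∀ θ ∈ paramSet p a b, ∀ {ι : Type} [Fintype ι] [DecidableEq ι]
      (u : ι → Fin d → ℤ) (x : ι → EuclideanSpace ℝ (Fin d)), Function.Injective u →
      (∀ i k, |x i k| ≤ 1) → IsRegular c C (covFamily a b K ε θ u x) := by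
  have hs : 0 < 1 - 2 * ε := by linarith [hε.2]
  obtain ⟨c, hc, hcoer⟩ := hK.exists_coercive hs
  obtain ⟨D, hD, hdecay⟩ := hK.exists_decay
  have hT : 0 ≤ ∑' w : Fin d → ℤ, decayProfile d (1 - 2 * ε) w :=
    tsum_nonneg fun w => (decayProfile_pos hs w).le
  refine ⟨c, D * ∑' w : Fin d → ℤ, decayProfile d (1 - 2 * ε) w, hc, by positivity,
    fun θ hθ {ι} _ _ u x hu hx => ⟨fun I hI => ?_, ?_⟩⟩
  · refine l2_opNorm_le_of_row_col_sum _ (by positivity) (fun i => ?_) fun j => ?_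
    · refine (Finset.sum_le_sum fun j _ => abs_covFamily_le hD hdecay hε hθ u hx hI i j).trans ?_
      rw [← Finset.mul_sum]
      exact mul_le_mul_of_nonneg_left (sum_decayProfile_sub_le hs hu _) hD
    · refine (Finset.sum_le_sum fun i _ => abs_covFamily_le hD hdecay hε hθ u hx hI i j).trans ?_
      rw [← Finset.mul_sum]
      exact mul_le_mul_of_nonneg_left (sum_decayProfile_sub_le' hs hu _) hD
  · exact hcoer θ hθ u (gridPoint ε u x) hu (le_norm_gridPoint_sub hε u hx)

/-- The trace of the product of factors `w` at the points `u_i + ε x_i`. -/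
def covTrace [Fintype ι] [DecidableEq ι] (a b : ℝ)
    (K : (Fin p → ℝ) → EuclideanSpace ℝ (Fin d) → ℝ) (ε : ℝ) (θ : Fin p → ℝ)
    (w : List (FactorLabel p)) (u : ι → Fin d → ℤ) (x : ι → EuclideanSpace ℝ (Fin d)) : ℝ :=
  (wordEval (covFamily a b K ε θ u x) w).trace

theorem covTrace_comp_equiv [Fintype ι] [DecidableEq ι] [Fintype κ] [DecidableEq κ] (ε : ℝ)
    (θ : Fin p → ℝ) (w : List (FactorLabel p)) (u : ι → Fin d → ℤ)
    (x : ι → EuclideanSpace ℝ (Fin d)) (e : κ ≃ ι) :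
    covTrace a b K ε θ w (u ∘ e) (x ∘ e) = covTrace a b K ε θ w u x := by
  rw [covTrace, covTrace, ← trace_submatrix_equiv _ e, ← wordEval_submatrix]
  rfl

theorem covTrace_add_const [Fintype ι] [DecidableEq ι] (ε : ℝ) (θ : Fin p → ℝ)
    (w : List (FactorLabel p)) (u : ι → Fin d → ℤ) (x : ι → EuclideanSpace ℝ (Fin d))
    (z : Fin d → ℤ) :
    covTrace a b K ε θ w (fun i => u i + z) x = covTrace a b K ε θ w u x := by
  rw [covTrace, covTrace, covFamily_add_const]

theorem ModelCondition.exists_norm_wordEval_le (hK : ModelCondition a b K) {ε : ℝ}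
    (hε : ε ∈ Set.Ico (0 : ℝ) (1 / 2)) (w : List (FactorLabel p)) :
    ∃ B : ℝ, 0 ≤ B ∧ ∀ θ ∈ paramSet p a b, ∀ {ι : Type} [Fintype ι] [DecidableEq ι]
      (u : ι → Fin d → ℤ) (x : ι → EuclideanSpace ℝ (Fin d)), Function.Injective u →
      (∀ i k, |x i k| ≤ 1) → ‖wordEval (covFamily a b K ε θ u x) w‖ ≤ B := by
  obtain ⟨c, C, hc, hC, hreg⟩ := hK.exists_isRegular hε
  obtain ⟨B, hB, H⟩ := IsStable.wordEval hc hC w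
  exact ⟨B, hB, fun θ hθ {ι} _ _ u x hu hx => (H _ (hreg θ hθ u x hu hx)).1⟩

theorem ModelCondition.exists_abs_covTrace_le (hK : ModelCondition a b K) {ε : ℝ}
    (hε : ε ∈ Set.Ico (0 : ℝ) (1 / 2)) (w : List (FactorLabel p)) :
    ∃ B : ℝ, 0 ≤ B ∧ ∀ θ ∈ paramSet p a b, ∀ {ι : Type} [Fintype ι] [DecidableEq ι]
      (u : ι → Fin d → ℤ) (x : ι → EuclideanSpace ℝ (Fin d)), Function.Injective u →
      (∀ i k, |x i k| ≤ 1) → |covTrace a b K ε θ w u x| ≤ B * Fintype.card ι := by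
  obtain ⟨B, hB, H⟩ := hK.exists_norm_wordEval_le hε w
  refine ⟨B, hB, fun θ hθ {ι} _ _ u x hu hx => (abs_trace_le _).trans ?_⟩
  rw [mul_comm]
  gcongr
  exact H θ hθ u x hu hx

/-- Restricting to a fibre of `π` gives another covariance family, regular with the same constants,
so decoupling applies; the cross entries are controlled by `abs_covFamily_le`. -/
theorem ModelCondition.exists_abs_covTrace_sub_sum_le (hK : ModelCondition a b K) {ε : ℝ}
    (hε : ε ∈ Set.Ico (0 : ℝ) (1 / 2)) (w : List (FactorLabel p)) :
    ∃ B : ℝ, 0 ≤ B ∧ ∀ θ ∈ paramSet p a b, ∀ {ι β : Type} [Fintype ι] [DecidableEq ι]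
      [Fintype β] [DecidableEq β] (π : ι → β) (u : ι → Fin d → ℤ)
      (x : ι → EuclideanSpace ℝ (Fin d)), Function.Injective u → (∀ i k, |x i k| ≤ 1) →
      |covTrace a b K ε θ w u x - ∑ β₀, covTrace a b K ε θ w
        (fun i : {i // π i = β₀} => u i) (fun i : {i // π i = β₀} => x i)|
      ≤ B * ∑ i, ∑ j, if π i = π j then 0 else decayProfile d (1 - 2 * ε) (u i - u j) := by
  have hs : 0 < 1 - 2 * ε := by linarith [hε.2]
  obtain ⟨c, C, hc, hC, hreg⟩ := hK.exists_isRegular hε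
  obtain ⟨D, hD, hdecay⟩ := hK.exists_decay
  obtain ⟨B, hB, H⟩ := exists_abs_trace_wordEval_sub_sum_le hc hC w
  refine ⟨B * D, by positivity, fun θ hθ {ι β} _ _ _ _ π u x hu hx => ?_⟩
  rw [mul_assoc]
  refine H π (covFamily a b K ε θ u x) (hreg θ hθ u x hu hx)
    (fun β₀ => hreg θ hθ _ _ (hu.comp Subtype.val_injective) fun i k => hx i k) _ ?_ fun I hI => ?_
  · refine mul_nonneg hD (Finset.sum_nonneg fun i _ => Finset.sum_nonneg fun j _ => ?_)
    split_ifs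
    exacts [le_rfl, (decayProfile_pos hs _).le]
  · simp only [Finset.mul_sum, mul_ite, mul_zero]
    refine Finset.sum_le_sum fun i _ => Finset.sum_le_sum fun j _ => ?_
    split_ifs
    exacts [le_rfl, abs_covFamily_le hD hdecay hε hθ u hx hI i j]

end Covariance

/-! ### Grid sequences and the bound on singular values. -/

section GridSequence

variable {d p : ℕ} {a b : ℝ} {K : (Fin p → ℝ) → EuclideanSpace ℝ (Fin d) → ℝ}

/-- The grid positions `v_i`, as points of `ℤ^d`. -/
def intGrid (v : ℕ → Fin d → ℕ) (i : ℕ) : Fin d → ℤ := fun k => (v i k : ℤ)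

/-- A surjection from `N ^ d` indices onto `N ^ d` points is injective, and since `d ≥ 1` any two
indices lie below some `N ^ d`. -/
theorem IsGridSequence.injective (hd : 1 ≤ d) {v : ℕ → Fin d → ℕ} (hv : IsGridSequence v) :
    Function.Injective v := by
  have key : ∀ N : ℕ, 1 ≤ N → Set.InjOn v {i | i < N ^ d} := fun N hN => by
    have himg : v '' (Finset.range (N ^ d) : Set ℕ)
        = (Fintype.piFinset fun _ : Fin d => Finset.Icc 1 N : Finset (Fin d → ℕ)) := by
      have h1 : ((Finset.range (N ^ d) : Finset ℕ) : Set ℕ) = {i | i < N ^ d} := by ext; simp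
      rw [h1, hv N hN]
      ext u
      simp only [Set.mem_ofPred_eq, Finset.mem_coe, Fintype.mem_piFinset, Finset.mem_Icc]
    have hcard : (Finset.image v (Finset.range (N ^ d))).card = (Finset.range (N ^ d)).card := by
      have : Finset.image v (Finset.range (N ^ d))
          = Fintype.piFinset fun _ : Fin d => Finset.Icc 1 N := by
        apply Finset.coe_injective
        rw [Finset.coe_image, himg]
      rw [this, Fintype.card_piFinset]
      simp
    have h2 := Finset.card_image_iff.1 hcard
    intro i hi j hj hij
    exact h2 (by simpa using hi) (by simpa using hj) hij
  intro i j hij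
  have h : ∀ m : ℕ, m ≤ i + j → m < (i + j + 1) ^ d := fun m hm =>
    lt_of_lt_of_le (by omega) (Nat.le_self_pow (by omega) _)
  exact key (i + j + 1) (by omega) (h i (by omega)) (h j (by omega)) hij

theorem intGrid_injective {v : ℕ → Fin d → ℕ} (hv : Function.Injective v) :
    Function.Injective (intGrid v) := fun i j h => hv (funext fun k => by
  exact Int.ofNat.inj (congrFun h k))

theorem ndMatrix_eq_ndEval {n : ℕ} (v : ℕ → Fin d → ℕ) (ε : ℝ)
    (x : Fin n → EuclideanSpace ℝ (Fin d)) (θ : Fin p → ℝ) :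
    ndMatrix a b K v ε x θ = ndEval (covFamily a b K ε θ (fun i : Fin n => intGrid v i) x) := by
  have hpt : gridPoint ε (fun i : Fin n => intGrid v i) x = obsPoint v ε x := by
    funext i
    ext k
    simp [gridPoint, obsPoint, intGrid]
  have hcov : ∀ I : List (Fin p), (Matrix.of fun i j => iterPartial a b I
      (fun θ' => covMatrix K v ε x θ' i j) θ)
      = covFamily a b K ε θ (fun i : Fin n => intGrid v i) x I := fun I => by
    simp only [covFamily, hpt]; rfl
  funext I
  cases I with
  | deriv I hI => exact hcov I
  | inv => exact congrArg (·⁻¹) (hcov [])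

theorem factorMatrix_eq_factorEval {n : ℕ} (v : ℕ → Fin d → ℕ) (ε : ℝ)
    (x : Fin n → EuclideanSpace ℝ (Fin d)) (θ : Fin p → ℝ) :
    factorMatrix a b K v ε x θ
      = factorEval (covFamily a b K ε θ (fun i : Fin n => intGrid v i) x) := by
  funext s
  cases s with
  | nd I => exact congrFun (ndMatrix_eq_ndEval v ε x θ) I
  | sd =>
    have h := congrFun (ndMatrix_eq_ndEval (a := a) (b := b) (K := K) v ε x θ) NdIndex.inv
    simp only [ndMatrix, ndEval] at h
    simp only [factorMatrix, factorEval, h]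
    rfl
  | bd L =>
    simp only [factorMatrix, factorEval, ndProduct, ndMatrix_eq_ndEval]
    rfl

theorem wordMatrix_eq_wordEval {n : ℕ} (v : ℕ → Fin d → ℕ) (ε : ℝ)
    (x : Fin n → EuclideanSpace ℝ (Fin d)) (θ : Fin p → ℝ) (w : List (FactorLabel p)) :
    wordMatrix a b K v ε x θ w
      = wordEval (covFamily a b K ε θ (fun i : Fin n => intGrid v i) x) w := by
  rw [wordMatrix, factorMatrix_eq_factorEval, wordEval]

/-- An eigenvector `y` of `T* T` for the eigenvalue `σ²` satisfies `‖T y‖ = σ ‖y‖`; beyond the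
dimension the singular values are 0 by convention. -/
theorem singularValues_le_l2_opNorm {n : ℕ} (A : Matrix (Fin n) (Fin n) ℝ) (j : ℕ) :
    (Matrix.toEuclideanLin A).singularValues j ≤ ‖A‖ := by
  set T := Matrix.toEuclideanLin A
  rcases lt_or_ge j (Module.finrank ℝ (EuclideanSpace ℝ (Fin n))) with hj | hj
  · obtain ⟨y, hy⟩ := (T.hasEigenvalue_adjoint_comp_self_sq_singularValues hj).exists_hasEigenvector
    have h1 : inner ℝ (T y) (T y) = T.singularValues j ^ 2 * inner ℝ y y := by
      have h2 := congrArg (fun z => inner ℝ z y) hy.apply_eq_smul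
      simp only [LinearMap.comp_apply, LinearMap.adjoint_inner_left, inner_smul_left,
        conj_trivial] at h2
      exact h2
    rw [real_inner_self_eq_norm_sq, real_inner_self_eq_norm_sq, ← mul_pow] at h1
    have h3 : T.singularValues j * ‖y‖ = ‖T y‖ :=
      ((pow_left_inj₀ (norm_nonneg _) (mul_nonneg (T.singularValues_nonneg j) (norm_nonneg _))
        two_ne_zero).1 h1).symm
    have h4 : ‖T y‖ ≤ ‖A‖ * ‖y‖ := Matrix.l2_opNorm_mulVec A y
    exact le_of_mul_le_mul_right (h3.trans_le h4) (norm_pos_iff.2 hy.2)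
  · rw [T.singularValues_of_finrank_le hj]
    exact norm_nonneg _

theorem exists_singularValues_le (hd : 1 ≤ d) (hK : ModelCondition a b K)
    {S : Set (EuclideanSpace ℝ (Fin d))} (hS : ∀ x ∈ S, ∀ k, |x k| ≤ 1) {v : ℕ → Fin d → ℕ}
    (hv : IsGridSequence v) {ε : ℝ} (hε : ε ∈ Set.Ico (0 : ℝ) (1 / 2))
    (w : List (FactorLabel p)) :
    ∃ C : ℝ, ∀ θ ∈ paramSet p a b, ∀ (n : ℕ) (x : Fin n → EuclideanSpace ℝ (Fin d)),
      (∀ i, x i ∈ S) → ∀ j : ℕ,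
        (Matrix.toEuclideanLin (wordMatrix a b K v ε x θ w)).singularValues j ≤ C := by
  obtain ⟨B, -, H⟩ := hK.exists_norm_wordEval_le hε w
  refine ⟨B, fun θ hθ n x hx j => (singularValues_le_l2_opNorm _ j).trans ?_⟩
  rw [wordMatrix_eq_wordEval]
  exact H θ hθ _ x ((intGrid_injective (hv.injective hd)).comp Fin.val_injective)
    fun i => hS _ (hx i)

end GridSequence

end PerturbedGrid

namespace PerturbedGrid

/-! ### The boundary effect is negligible for large boxes. -/

section BoundaryLoss

variable {d : ℕ} {s : ℝ}

/-- The points of the box `{0, ..., L - 1}^d` which the shift by `w` moves out of the box. -/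
def exitSet (d L : ℕ) (w : Fin d → ℤ) : Finset (Fin d → Fin L) :=
  Finset.univ.filter fun l => ¬ ∀ k, 0 ≤ (l k : ℤ) + w k ∧ (l k : ℤ) + w k < L

/-- The weighted proportion of pairs made of a point of `{0, ..., L - 1}^d` and a point outside. -/
def boundaryLoss (d : ℕ) (s : ℝ) (L : ℕ) : ℝ :=
  ∑' w : Fin d → ℤ, decayProfile d s w * ((exitSet d L w).card / (L : ℝ) ^ d)

theorem card_exitSet_div_le_one (L : ℕ) (w : Fin d → ℤ) :
    ((exitSet d L w).card : ℝ) / (L : ℝ) ^ d ≤ 1 := by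
  refine div_le_one_of_le₀ ?_ (by positivity)
  have h := (exitSet d L w).card_le_univ
  rw [Fintype.card_fun, Fintype.card_fin, Fintype.card_fin] at h
  exact_mod_cast h

/-- Only points within `|z|` of one of the two ends can leave, at most `2 |z|` in all. -/
theorem tendsto_card_stay_div (z : ℤ) : Tendsto (fun L : ℕ =>
    ((Finset.univ.filter fun a : Fin L => 0 ≤ (a : ℤ) + z ∧ (a : ℤ) + z < L).card : ℝ) / L)
    atTop (𝓝 1) := by
  have hlow : Tendsto (fun L : ℕ => 1 - (2 * |z| : ℝ) / L) atTop (𝓝 1) := by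
    simpa using (tendsto_const_div_atTop_nhds_zero_nat (2 * |z| : ℝ)).const_sub 1
  refine tendsto_of_tendsto_of_tendsto_of_le_of_le' hlow tendsto_const_nhds ?_ ?_
  · filter_upwards [eventually_gt_atTop 0] with L hL
    have hL' : (0 : ℝ) < L := by exact_mod_cast hL
    have hsplit := Finset.card_filter_add_card_filter_not (s := (Finset.univ : Finset (Fin L)))
      (fun a : Fin L => 0 ≤ (a : ℤ) + z ∧ (a : ℤ) + z < L)
    have hbad : (Finset.univ.filter fun a : Fin L =>
        ¬ (0 ≤ (a : ℤ) + z ∧ (a : ℤ) + z < L)).card ≤ (2 * |z|).toNat := by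
      have hmap : ∀ a ∈ Finset.univ.filter fun a : Fin L =>
          ¬ (0 ≤ (a : ℤ) + z ∧ (a : ℤ) + z < L),
          (a : ℤ) ∈ Finset.Ico 0 |z| ∪ Finset.Ico ((L : ℤ) - |z|) L := fun a ha => by
        have ha2 := (Finset.mem_filter.1 ha).2
        have ha3 : (a : ℤ) < L := by exact_mod_cast a.2
        have := neg_abs_le z
        have := le_abs_self z
        simp only [Finset.mem_union, Finset.mem_Ico]
        by_contra hcon
        apply ha2
        omega
      refine (Finset.card_le_card_of_injOn _ hmap ?_).trans ((Finset.card_union_le _ _).trans ?_)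
      · intro a _ a' _ h
        exact Fin.ext (Int.ofNat.inj h)
      · rw [Int.card_Ico, Int.card_Ico]
        have := abs_nonneg z
        omega
    rw [Finset.card_univ, Fintype.card_fin] at hsplit
    have hbad' : ((Finset.univ.filter fun a : Fin L =>
        ¬ (0 ≤ (a : ℤ) + z ∧ (a : ℤ) + z < L)).card : ℝ) ≤ 2 * |z| := by
      have h1 : (((2 * |z|).toNat : ℤ) : ℝ) = 2 * |z| := by
        rw [Int.toNat_of_nonneg (by positivity)]; push_cast; rfl
      rw [← h1]
      exact_mod_cast hbad
    have hsplit' := congrArg (Nat.cast (R := ℝ)) hsplit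
    push_cast at hsplit'
    rw [one_sub_div hL'.ne']
    gcongr
    linarith
  · filter_upwards with L
    refine div_le_one_of_le₀ ?_ (by positivity)
    have h := (Finset.univ.filter fun a : Fin L =>
      0 ≤ (a : ℤ) + z ∧ (a : ℤ) + z < L).card_le_univ
    rw [Fintype.card_fin] at h
    exact_mod_cast h

/-- The proportion of points that stay is a product over the coordinates, each factor tending to 1.
-/
theorem tendsto_card_exitSet_div (w : Fin d → ℤ) :
    Tendsto (fun L : ℕ => ((exitSet d L w).card : ℝ) / (L : ℝ) ^ d) atTop (𝓝 0) := by
  have h1 : Tendsto (fun L : ℕ => 1 - ∏ k, ((Finset.univ.filter fun a : Fin L =>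
      0 ≤ (a : ℤ) + w k ∧ (a : ℤ) + w k < L).card : ℝ) / L) atTop (𝓝 0) := by
    have := (tendsto_finsetProd Finset.univ fun k _ => tendsto_card_stay_div (w k)).const_sub 1
    simpa using this
  refine h1.congr' ?_
  filter_upwards [eventually_gt_atTop 0] with L hL
  have hL' : (0 : ℝ) < L := by exact_mod_cast hL
  have hsplit := Finset.card_filter_add_card_filter_not
    (s := (Finset.univ : Finset (Fin d → Fin L)))
    (fun l => ∀ k, 0 ≤ (l k : ℤ) + w k ∧ (l k : ℤ) + w k < L)
  have hpi : (Finset.univ.filter fun l : Fin d → Fin L =>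
      ∀ k, 0 ≤ (l k : ℤ) + w k ∧ (l k : ℤ) + w k < L)
      = Fintype.piFinset fun k => Finset.univ.filter fun a : Fin L =>
        0 ≤ (a : ℤ) + w k ∧ (a : ℤ) + w k < L := by
    ext l; simp only [Finset.mem_filter, Finset.mem_univ, true_and, Fintype.mem_piFinset]
  rw [hpi, Fintype.card_piFinset, Finset.card_univ, Fintype.card_fun, Fintype.card_fin,
    Fintype.card_fin] at hsplit
  have hsplit' := congrArg (Nat.cast (R := ℝ)) hsplit
  push_cast at hsplit'
  rw [Finset.prod_div_distrib, Finset.prod_const, Finset.card_univ, Fintype.card_fin,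
    one_sub_div (by positivity), exitSet]
  congr 1
  linarith

/-- Dominated convergence for series: proportions are at most 1 and the decay profile is summable.
-/
theorem tendsto_boundaryLoss (hs : 0 < s) : Tendsto (boundaryLoss d s) atTop (𝓝 0) := by
  have h := tendsto_tsum_of_dominated_convergence (𝓕 := atTop)
    (f := fun (L : ℕ) (w : Fin d → ℤ) => decayProfile d s w * ((exitSet d L w).card / (L : ℝ) ^ d))
    (g := fun _ => 0) (bound := decayProfile d s) (summable_decayProfile hs)
    (fun w => by simpa using (tendsto_card_exitSet_div w).const_mul (decayProfile d s w))
    (Eventually.of_forall fun L w => by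
      rw [Real.norm_of_nonneg (mul_nonneg (decayProfile_pos hs w).le (by positivity))]
      exact mul_le_of_le_one_right (decayProfile_pos hs w).le (card_exitSet_div_le_one L w))
  simp only [tsum_zero] at h
  exact h

end BoundaryLoss

/-! ### Tiling a box and enumerating it. -/

section Boxes

variable {d : ℕ}

/-- The point `L β + l` of the box `{0, ..., k L - 1}^d`. -/
def boxPoint {k L : ℕ} (q : (Fin d → Fin k) × (Fin d → Fin L)) : Fin d → ℤ :=
  fun i => L * (q.1 i : ℤ) + (q.2 i : ℤ)

theorem boxPoint_injective {k L : ℕ} :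
    Function.Injective (boxPoint (d := d) (k := k) (L := L)) := by
  rintro ⟨β, l⟩ ⟨β', l'⟩ h
  have key : ∀ i, β i = β' i ∧ l i = l' i := fun i => by
    have h1 : (L * (β i : ℕ) + (l i : ℕ) : ℕ) = L * (β' i : ℕ) + (l' i : ℕ) := by
      have h0 := congrFun h i
      simp only [boxPoint] at h0
      exact_mod_cast h0
    have hL : 0 < L := Fin.pos (l i)
    have h2 := congrArg (· / L) h1
    have h3 := congrArg (· % L) h1
    simp only [Nat.mul_add_div hL, Nat.div_eq_of_lt (l i).2, Nat.div_eq_of_lt (l' i).2,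
      Nat.mul_add_mod, Nat.mod_eq_of_lt (l i).2, Nat.mod_eq_of_lt (l' i).2, add_zero] at h2 h3
    exact ⟨Fin.ext h2, Fin.ext h3⟩
  exact Prod.ext (funext fun i => (key i).1) (funext fun i => (key i).2)

/-- For fixed `q` the shift to `q'` determines `q'`, and if the blocks differ this shift moves `q.2`
out of its box. Summing over all shifts and then over `q` counts each `exitSet` `k ^ d` times. -/
theorem sum_cross_boxPoint_le {s : ℝ} (hs : 0 < s) {k L : ℕ} (hL : 0 < L) :
    ∑ q : (Fin d → Fin k) × (Fin d → Fin L), ∑ q' : (Fin d → Fin k) × (Fin d → Fin L),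
      (if q.1 = q'.1 then 0 else decayProfile d s (boxPoint q - boxPoint q'))
      ≤ ((k * L : ℕ) : ℝ) ^ d * boundaryLoss d s L := by
  classical
  have hsum : ∀ l : Fin d → Fin L, Summable fun w : Fin d → ℤ =>
      if l ∈ exitSet d L w then decayProfile d s w else 0 := fun l =>
    Summable.of_nonneg_of_le
      (fun w => by split_ifs; exacts [(decayProfile_pos hs w).le, le_rfl])
      (fun w => by split_ifs; exacts [le_rfl, (decayProfile_pos hs w).le])
      (summable_decayProfile hs)
  have hrow : ∀ q : (Fin d → Fin k) × (Fin d → Fin L),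
      ∑ q' : (Fin d → Fin k) × (Fin d → Fin L),
        (if q.1 = q'.1 then 0 else decayProfile d s (boxPoint q - boxPoint q'))
        ≤ ∑' w : Fin d → ℤ, if q.2 ∈ exitSet d L w then decayProfile d s w else 0 := by
    intro q
    have hinj : Function.Injective fun q' : (Fin d → Fin k) × (Fin d → Fin L) =>
        boxPoint q' - boxPoint q := fun q₁ q₂ h => boxPoint_injective (sub_left_injective h)
    rw [← tsum_fintype (L := .unconditional _)]
    refine Summable.tsum_le_tsum_of_inj _ hinj
      (fun w _ => by split_ifs; exacts [(decayProfile_pos hs w).le, le_rfl]) (fun q' => ?_)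
      (hasSum_fintype _).summable (hsum q.2)
    by_cases h : q.1 = q'.1
    · rw [if_pos h]; split_ifs; exacts [(decayProfile_pos hs _).le, le_rfl]
    · have hmem : q.2 ∈ exitSet d L (boxPoint q' - boxPoint q) := by
        refine Finset.mem_filter.2 ⟨Finset.mem_univ _, fun hall => h ?_⟩
        funext i
        have h1 := hall i
        simp only [Pi.sub_apply, boxPoint] at h1
        have h2 : ((q'.2 i : ℕ) : ℤ) < L := by exact_mod_cast (q'.2 i).2
        have h3 : (0 : ℤ) ≤ ((q'.2 i : ℕ) : ℤ) := by positivity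
        -- Staying in the box means `0 ≤ L (β' - β) + l' < L` in each coordinate, which forces `β' =
        -- β`.
        have h4 : (L : ℤ) * ((q'.1 i : ℕ) - (q.1 i : ℕ) : ℤ) < L * 1 := by linarith [h1.2]
        have h5 : (L : ℤ) * (-1) < L * ((q'.1 i : ℕ) - (q.1 i : ℕ) : ℤ) := by linarith [h1.1]
        have hL' : (0 : ℤ) ≤ L := by positivity
        have h6 := lt_of_mul_lt_mul_left h4 hL'
        have h7 := lt_of_mul_lt_mul_left h5 hL'
        exact Fin.ext (by omega)
      rw [if_neg h, if_pos hmem, ← decayProfile_neg, neg_sub]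
  refine (Finset.sum_le_sum fun q _ => hrow q).trans (le_of_eq ?_)
  have hL' : (0 : ℝ) < L := by exact_mod_cast hL
  rw [Fintype.sum_prod_type]
  change ∑ _β : Fin d → Fin k, ∑ l : Fin d → Fin L,
    (∑' w : Fin d → ℤ, if l ∈ exitSet d L w then decayProfile d s w else 0) = _
  simp only [Finset.sum_const, Finset.card_univ, Fintype.card_fun, Fintype.card_fin, nsmul_eq_mul]
  rw [← Summable.tsum_finsetSum fun l _ => hsum l, boundaryLoss, Nat.cast_mul, mul_pow, mul_assoc, ← tsum_mul_left (a := (L : ℝ) ^ d), Nat.cast_pow]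
  congr 1
  refine tsum_congr fun w => ?_
  rw [Finset.sum_ite_mem, Finset.univ_inter, Finset.sum_const, nsmul_eq_mul]
  field_simp

/-- The enumeration of `ℕ^d` underlying a grid sequence. -/
theorem IsGridSequence.exists_equiv (hd : 1 ≤ d) {v : ℕ → Fin d → ℕ} (hv : IsGridSequence v) :
    ∃ e : (Fin d → ℕ) ≃ ℕ, (∀ y k, v (e y) k = y k + 1) ∧
      ∀ N : ℕ, ∀ y : Fin d → ℕ, e y < N ^ d ↔ ∀ k, y k < N := by
  have hinj := hv.injective hd
  have hmem : ∀ N : ℕ, 1 ≤ N → ∀ u : Fin d → ℕ,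
      (∃ i, i < N ^ d ∧ v i = u) ↔ ∀ k, 1 ≤ u k ∧ u k ≤ N := fun N hN u => by
    have := Set.ext_iff.1 (hv N hN) u
    simpa using this
  have hpos : ∀ i k, 1 ≤ v i k := fun i k =>
    ((hmem (i + 1) (by omega) (v i)).1
      ⟨i, lt_of_lt_of_le (by omega) (Nat.le_self_pow (by omega) _), rfl⟩ k).1
  have hex : ∀ y : Fin d → ℕ, ∃ i, v i = fun k => y k + 1 := fun y => by
    obtain ⟨i, -, hi⟩ := (hmem (Finset.univ.sup y + 1) (by omega) fun k => y k + 1).2 fun k =>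
      ⟨by omega, by have := Finset.le_sup (f := y) (Finset.mem_univ k); omega⟩
    exact ⟨i, hi⟩
  choose f hf using hex
  have hbij : Function.Bijective f := by
    refine ⟨fun y y' h => ?_, fun i => ⟨fun k => v i k - 1, hinj ?_⟩⟩
    · have := (hf y).symm.trans ((congrArg v h).trans (hf y'))
      funext k
      have := congrFun this k
      simpa using this
    · rw [hf]
      funext k
      have := hpos i k
      omega
  refine ⟨Equiv.ofBijective f hbij, fun y k => congrFun (hf y) k, fun N y => ?_⟩
  rw [Equiv.ofBijective_apply]
  rcases Nat.eq_zero_or_pos N with rfl | hN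
  · have : Nonempty (Fin d) := ⟨⟨0, hd⟩⟩
    simp [zero_pow (Nat.pos_iff_ne_zero.1 hd)]
  · have h1 := hmem N hN fun k => y k + 1
    have h2 : (∃ i, i < N ^ d ∧ v i = fun k => y k + 1) ↔ f y < N ^ d :=
      ⟨fun ⟨i, hi, hvi⟩ => by rwa [← hinj (hvi.trans (hf y).symm)], fun h => ⟨f y, h, hf y⟩⟩
    rw [← h2, h1]
    exact forall_congr' fun k => by omega

/-- The bijection between the box `{0, ..., N - 1}^d` and the first `N^d` indices. -/
theorem exists_box_equiv {e : (Fin d → ℕ) ≃ ℕ}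
    (he : ∀ N : ℕ, ∀ y : Fin d → ℕ, e y < N ^ d ↔ ∀ k, y k < N) (N : ℕ) :
    ∃ f : (Fin d → Fin N) ≃ Fin (N ^ d), ∀ l, (f l : ℕ) = e fun k => l k := by
  let g : (Fin d → Fin N) → Fin (N ^ d) := fun l =>
    ⟨e fun k => l k, (he N _).2 fun k => (l k).2⟩
  refine ⟨Equiv.ofBijective g ⟨fun l l' h => ?_, fun i => ?_⟩, fun l => rfl⟩
  · have h1 := e.injective (Fin.ext_iff.1 h)
    funext k
    exact Fin.ext (congrFun h1 k)
  · have h1 : ∀ k, e.symm i k < N := (he N _).1 (by rw [e.apply_symm_apply]; exact i.2)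
    exact ⟨fun k => ⟨e.symm i k, h1 k⟩, Fin.ext (by simp [g])⟩

end Boxes

end PerturbedGrid

namespace PerturbedGrid

/-! ### Comparing traces of nested and tiled configurations. -/

section TraceBounds

variable {d p : ℕ} {a b : ℝ} {K : (Fin p → ℝ) → EuclideanSpace ℝ (Fin d) → ℝ}

/-- The trace of the product of factors `w` for the perturbed box `{0, ..., L - 1}^d`. -/
def blockTrace (a b : ℝ) (K : (Fin p → ℝ) → EuclideanSpace ℝ (Fin d) → ℝ) (ε : ℝ)
    (θ : Fin p → ℝ) (w : List (FactorLabel p)) (L : ℕ)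
    (y : (Fin d → Fin L) → EuclideanSpace ℝ (Fin d)) : ℝ :=
  covTrace a b K ε θ w (fun l k => ((l k : ℕ) : ℤ)) y

/-- Adding points to a configuration changes the trace at most proportionally. -/
theorem ModelCondition.exists_abs_covTrace_sub_le (hK : ModelCondition a b K) {ε : ℝ}
    (hε : ε ∈ Set.Ico (0 : ℝ) (1 / 2)) (w : List (FactorLabel p)) :
    ∃ B : ℝ, 0 ≤ B ∧ ∀ θ ∈ paramSet p a b, ∀ (u : ℕ → Fin d → ℤ)
      (x : ℕ → EuclideanSpace ℝ (Fin d)), Function.Injective u → (∀ i k, |x i k| ≤ 1) →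
      ∀ m n : ℕ, m ≤ n →
      |covTrace a b K ε θ w (fun i : Fin n => u i) (fun i => x i)
        - covTrace a b K ε θ w (fun i : Fin m => u i) (fun i => x i)| ≤ B * (n - m) := by
  have hs : 0 < 1 - 2 * ε := by linarith [hε.2]
  obtain ⟨B, hB, hbd⟩ := hK.exists_abs_covTrace_le hε w
  obtain ⟨D, hD, hdec⟩ := hK.exists_abs_covTrace_sub_sum_le hε w
  set G := ∑' w : Fin d → ℤ, decayProfile d (1 - 2 * ε) w
  have hG : 0 ≤ G := tsum_nonneg fun w => (decayProfile_pos hs w).le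
  -- The first term pays for cutting off the added points, the second for the trace over them.
  refine ⟨D * (2 * G) + B, by positivity, fun θ hθ u x hu hx m n hmn => ?_⟩
  let π : Fin n → Bool := fun i => decide ((i : ℕ) < m)
  have hun : Function.Injective fun i : Fin n => u i := hu.comp Fin.val_injective
  have h1 := hdec θ hθ π (fun i : Fin n => u i) (fun i => x i) hun fun i => hx i
  rw [Fintype.sum_bool] at h1
  have hcount : ((Finset.univ.filter fun i : Fin n => m ≤ (i : ℕ)).card : ℝ) = n - m := by
    have h2 : (Finset.univ.filter fun i : Fin n => (i : ℕ) < m).card = m := by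
      rw [Fin.card_filter_val_lt, min_eq_right hmn]
    have h3 := Finset.card_filter_add_card_filter_not (s := (Finset.univ : Finset (Fin n)))
      (fun i : Fin n => (i : ℕ) < m)
    rw [h2, Finset.card_univ, Fintype.card_fin] at h3
    simp only [not_lt] at h3
    rw [eq_sub_iff_add_eq']
    exact_mod_cast h3
  have hcross : ∑ i, ∑ j, (if π i = π j then 0 else
      decayProfile d (1 - 2 * ε) (u (i : Fin n) - u (j : Fin n))) ≤ 2 * G * (n - m) := by
    -- A cross pair has an index that is at least `m`; each such index costs at most `G`.
    have hle : ∀ i j : Fin n, (if π i = π j then 0 else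
        decayProfile d (1 - 2 * ε) (u i - u j)) ≤
        (if m ≤ (i : ℕ) then decayProfile d (1 - 2 * ε) (u i - u j) else 0)
        + if m ≤ (j : ℕ) then decayProfile d (1 - 2 * ε) (u i - u j) else 0 := fun i j => by
      have hp := (decayProfile_pos (d := d) hs (u i - u j)).le
      by_cases hi : m ≤ (i : ℕ) <;> by_cases hj : m ≤ (j : ℕ) <;>
        simp [π, hi, hj, not_lt.2, lt_of_not_ge, hp]
    refine (Finset.sum_le_sum fun i _ => Finset.sum_le_sum fun j _ => hle i j).trans ?_
    simp only [Finset.sum_add_distrib]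
    have hA : ∑ i : Fin n, ∑ j : Fin n, (if m ≤ (i : ℕ) then
        decayProfile d (1 - 2 * ε) (u i - u j) else 0) ≤ (n - m) * G := by
      rw [← hcount, ← nsmul_eq_mul, ← Finset.sum_const, Finset.sum_filter]
      refine Finset.sum_le_sum fun i _ => ?_
      split_ifs
      · exact sum_decayProfile_sub_le hs hun _
      · simp
    have hB' : ∑ i : Fin n, ∑ j : Fin n, (if m ≤ (j : ℕ) then
        decayProfile d (1 - 2 * ε) (u i - u j) else 0) ≤ (n - m) * G := by
      rw [Finset.sum_comm, ← hcount, ← nsmul_eq_mul, ← Finset.sum_const, Finset.sum_filter]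
      refine Finset.sum_le_sum fun i _ => ?_
      split_ifs
      · exact sum_decayProfile_sub_le' hs hun _
      · simp
    linarith
  have htrue : covTrace a b K ε θ w (fun i : {i : Fin n // π i = true} => u i) (fun i => x i)
      = covTrace a b K ε θ w (fun i : Fin m => u i) (fun i => x i) := by
    let e : Fin m ≃ {i : Fin n // π i = true} :=
      { toFun := fun i => ⟨⟨i, i.2.trans_le hmn⟩, by simp [π]⟩
        invFun := fun i => ⟨i.1, by simpa [π] using i.2⟩
        left_inv := fun i => rfl
        right_inv := fun i => rfl }
    exact (covTrace_comp_equiv ε θ w _ _ e).symm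
  have hfalse := hbd θ hθ (fun i : {i : Fin n // π i = false} => u i) (fun i => x i)
    (hun.comp Subtype.val_injective) fun i => hx i
  have hcard : (Fintype.card {i : Fin n // π i = false} : ℝ) = n - m := by
    rw [← hcount, Fintype.card_subtype]
    simp [π]
  rw [hcard] at hfalse
  rw [htrue] at h1
  have h4 := h1.trans (mul_le_mul_of_nonneg_left hcross hD)
  rw [abs_le] at h4 hfalse ⊢
  constructor <;> nlinarith [h4.1, h4.2, hfalse.1, hfalse.2]

/-- The trace for a box of side `k L` is close to the sum of the traces of its `k^d` blocks. -/
theorem ModelCondition.exists_abs_covTrace_sub_sum_blockTrace_le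
    (hK : ModelCondition a b K) {ε : ℝ} (hε : ε ∈ Set.Ico (0 : ℝ) (1 / 2))
    (w : List (FactorLabel p)) :
    ∃ B : ℝ, 0 ≤ B ∧ ∀ θ ∈ paramSet p a b, ∀ (v : ℕ → Fin d → ℕ) (e : (Fin d → ℕ) ≃ ℕ),
      IsGridSequence v → (∀ y k, v (e y) k = y k + 1) →
      (∀ N : ℕ, ∀ y : Fin d → ℕ, e y < N ^ d ↔ ∀ k, y k < N) →
      ∀ x : ℕ → EuclideanSpace ℝ (Fin d), (∀ i k, |x i k| ≤ 1) → ∀ k L : ℕ, 0 < L →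
      |covTrace a b K ε θ w (fun i : Fin ((k * L) ^ d) => intGrid v i) (fun i => x i)
        - ∑ m ∈ Finset.range (k ^ d), blockTrace a b K ε θ w L
          (fun l => x (e fun i => L * e.symm m i + l i))|
      ≤ B * boundaryLoss d (1 - 2 * ε) L * ((k * L : ℕ) : ℝ) ^ d := by
  have hs : 0 < 1 - 2 * ε := by linarith [hε.2]
  obtain ⟨B, hB, hdec⟩ := hK.exists_abs_covTrace_sub_sum_le hε w
  refine ⟨B, hB, fun θ hθ v e hv hve he x hx k L hL => ?_⟩
  obtain ⟨f, hf⟩ := exists_box_equiv he k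
  obtain ⟨g, hg⟩ := exists_box_equiv he (k * L)
  let c : (Fin d → Fin k) × (Fin d → Fin L) ≃ (Fin d → Fin (k * L)) :=
    (Equiv.arrowProdEquivProdArrow _ _ _).symm.trans (Equiv.piCongrRight fun _ => finProdFinEquiv)
  have hc : ∀ q i, ((c q i : Fin (k * L)) : ℕ) = L * q.1 i + q.2 i := fun q i => by
    simp [c, Equiv.arrowProdEquivProdArrow, add_comm]
  have hgc : ∀ q, (g (c q) : ℕ) = e fun i => L * q.1 i + q.2 i := fun q => by
    rw [hg]; simp only [hc]
  -- Grid coordinates start at 1 and box coordinates at 0; translation invariance absorbs the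
  -- offset.
  have hu : ∀ q, intGrid v (g (c q)) = boxPoint q + 1 := fun q => by
    funext i
    simp only [intGrid, hgc, hve, boxPoint, Pi.add_apply, Pi.one_apply]
    push_cast
    rfl
  have h1 : covTrace a b K ε θ w (fun i : Fin ((k * L) ^ d) => intGrid v i) (fun i => x i)
      = covTrace a b K ε θ w boxPoint
        (fun q : (Fin d → Fin k) × (Fin d → Fin L) => x (e fun i => L * q.1 i + q.2 i)) := by
    rw [← covTrace_comp_equiv ε θ w _ _ (c.trans g), ← covTrace_add_const ε θ w boxPoint _ 1]
    congr 1
    · funext q; exact hu q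
    · funext q
      simp only [Function.comp_apply, Equiv.trans_apply, hgc]
  -- Blocks are numbered by the same enumeration `e` as points, so the first `k ^ d` blocks tile the
  -- box of side `k L`.
  have h2 : ∑ m ∈ Finset.range (k ^ d), blockTrace a b K ε θ w L
        (fun l => x (e fun i => L * e.symm m i + l i))
      = ∑ β : Fin d → Fin k, covTrace a b K ε θ w
        (fun q : {q : (Fin d → Fin k) × (Fin d → Fin L) // q.1 = β} => boxPoint q.1)
        (fun q => x (e fun i => L * q.1.1 i + q.1.2 i)) := by
    rw [Finset.sum_range fun m => blockTrace a b K ε θ w L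
        (fun l => x (e fun i => L * e.symm m i + l i)), ← f.sum_comp]
    refine Finset.sum_congr rfl fun β _ => ?_
    let σ : (Fin d → Fin L) ≃ {q : (Fin d → Fin k) × (Fin d → Fin L) // q.1 = β} :=
      { toFun := fun l => ⟨(β, l), rfl⟩
        invFun := fun q => q.1.2
        left_inv := fun l => rfl
        right_inv := by rintro ⟨⟨β', l⟩, rfl⟩; rfl }
    rw [← covTrace_comp_equiv ε θ w _ _ σ, blockTrace,
      ← covTrace_add_const ε θ w (fun l : Fin d → Fin L => fun k => ((l k : ℕ) : ℤ)) _
        (fun i => L * ((β i : ℕ) : ℤ))]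
    congr 1
    · funext l i
      simp [σ, boxPoint, add_comm]
    · funext l
      simp only [Function.comp_apply, hf, Equiv.symm_apply_apply]
      rfl
  rw [h1, h2, mul_assoc, mul_comm (boundaryLoss _ _ _)]
  refine (hdec θ hθ Prod.fst boxPoint _ boxPoint_injective fun q => hx _).trans ?_
  exact mul_le_mul_of_nonneg_left (sum_cross_boxPoint_le hs hL) hB

end TraceBounds

/-! ### From box sizes to arbitrary sizes. -/

section Interpolation

/-- Let `k` be maximal with `(k L) ^ d ≤ n`. Then `(k L) ^ d / n → 1`, so passing from `n` to `(k L)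
^ d` costs `o(n)`, and only the tiling error `ρ` remains. -/
theorem eventually_abs_div_sub_le {d : ℕ} (hd : 1 ≤ d) {T : ℕ → ℝ} {B : ℝ}
    (hT : ∀ m n, m ≤ n → |T n - T m| ≤ B * (n - m)) {L : ℕ} (hL : 0 < L) {ρ M : ℝ}
    (hρ : 0 ≤ ρ) {A : ℕ → ℝ} (hTA : ∀ k : ℕ, |T ((k * L) ^ d) - A k| ≤ ρ * ((k * L : ℕ) : ℝ) ^ d)
    (hA : Tendsto (fun k : ℕ => A k / ((k * L : ℕ) : ℝ) ^ d) atTop (𝓝 M)) {η : ℝ} (hη : 0 < η) :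
    ∀ᶠ n : ℕ in atTop, |T n / n - M| ≤ ρ + η := by
  let r : ℕ → ℕ := fun n => Nat.findGreatest (fun k => (k * L) ^ d ≤ n) n
  have hr1 : ∀ n, (r n * L) ^ d ≤ n := fun n =>
    Nat.findGreatest_spec (P := fun k => (k * L) ^ d ≤ n) (Nat.zero_le n)
      (by simp [zero_pow (Nat.pos_iff_ne_zero.1 hd)])
  have hr2 : ∀ n, n < ((r n + 1) * L) ^ d := fun n => by
    by_contra! h
    have h1 : r n + 1 ≤ n := (Nat.le_mul_of_pos_right _ hL).trans
      ((Nat.le_self_pow (by omega) _).trans h)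
    have := Nat.le_findGreatest (P := fun k => (k * L) ^ d ≤ n) h1 h
    change r n + 1 ≤ r n at this
    omega
  have hr3 : Tendsto r atTop atTop := by
    refine tendsto_atTop.2 fun R => ?_
    filter_upwards [eventually_ge_atTop (R + (R * L) ^ d)] with n hn
    exact Nat.le_findGreatest (P := fun k => (k * L) ^ d ≤ n) (by omega) (by omega)
  have hratio : Tendsto (fun n : ℕ => ((r n * L : ℕ) : ℝ) ^ d / n) atTop (𝓝 1) := by
    have h1 : Tendsto (fun n : ℕ => ((r n : ℝ) / (r n + 1)) ^ d) atTop (𝓝 1) := by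
      simpa using ((tendsto_natCast_div_add_atTop (1 : ℝ)).comp hr3).pow d
    refine tendsto_of_tendsto_of_tendsto_of_le_of_le' h1 tendsto_const_nhds ?_ ?_
    · filter_upwards [eventually_gt_atTop 0] with n hn
      have hn' : (0 : ℝ) < n := by exact_mod_cast hn
      have h2 : (n : ℝ) ≤ ((r n + 1) * L) ^ d := by exact_mod_cast (hr2 n).le
      have hL' : (0 : ℝ) < L := by exact_mod_cast hL
      rw [div_pow, div_le_div_iff₀ (by positivity) hn', Nat.cast_mul, mul_pow, mul_assoc,
        ← mul_pow, mul_comm (L : ℝ)]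
      gcongr
    · filter_upwards with n
      refine div_le_one_of_le₀ ?_ (by positivity)
      exact_mod_cast hr1 n
  have hlim1 : Tendsto (fun n : ℕ => B * (1 - ((r n * L : ℕ) : ℝ) ^ d / n)) atTop (𝓝 0) := by
    simpa using (hratio.const_sub 1).const_mul B
  have hlim2 : Tendsto (fun n : ℕ => A (r n) / n) atTop (𝓝 M) := by
    have h1 := (hA.comp hr3).mul hratio
    rw [mul_one] at h1
    refine h1.congr' ?_
    filter_upwards [hr3.eventually_gt_atTop 0] with n hn
    have : (0 : ℝ) < ((r n * L : ℕ) : ℝ) := by exact_mod_cast Nat.mul_pos hn hL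
    simp only [Function.comp_apply]
    field_simp
  have he1 := hlim1.eventually (ge_mem_nhds (half_pos hη))
  have he2 := (Metric.tendsto_nhds.1 hlim2 (η / 2) (half_pos hη))
  filter_upwards [he1, he2, eventually_gt_atTop 0] with n h1 h2 hn
  have hn' : (0 : ℝ) < n := by exact_mod_cast hn
  set m := (r n * L) ^ d with hm
  have hmn : (m : ℝ) ≤ n := by exact_mod_cast hr1 n
  have hmc : ((r n * L : ℕ) : ℝ) ^ d = m := by rw [hm]; push_cast; rfl
  rw [hmc] at h1
  have t1 : |T n / n - T m / n| ≤ η / 2 := by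
    rw [← sub_div, abs_div, abs_of_pos hn']
    refine le_trans ?_ h1
    rw [div_le_iff₀ hn', mul_assoc, sub_mul, div_mul_cancel₀ _ hn'.ne', one_mul]
    exact hT m n (hr1 n)
  have t2 : |T m / n - A (r n) / n| ≤ ρ := by
    rw [← sub_div, abs_div, abs_of_pos hn', div_le_iff₀ hn']
    refine (hTA (r n)).trans ?_
    rw [hmc]
    gcongr
  rw [Real.dist_eq] at h2
  have e : T n / n - M = (T n / n - T m / n) + (T m / n - A (r n) / n) + (A (r n) / n - M) := by ring
  rw [e]
  refine (abs_add_le _ _).trans ?_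
  have := abs_add_le (T n / n - T m / n) (T m / n - A (r n) / n)
  linarith

end Interpolation

end PerturbedGrid

namespace PerturbedGrid

/-! ### Measurability in the perturbation. -/

section CovarianceMeasurability

variable {d p : ℕ} {a b : ℝ} {K : (Fin p → ℝ) → EuclideanSpace ℝ (Fin d) → ℝ}

theorem continuous_cosTransform {h : EuclideanSpace ℝ (Fin d) → ℝ} (hh : Integrable h) :
    Continuous (cosTransform h) := by
  refine continuous_of_dominated (bound := fun f => ‖h f‖)
    (fun t => (integrable_mul_cos hh t).aestronglyMeasurable) (fun t => ?_) hh.norm ?_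
  · refine Eventually.of_forall fun f => ?_
    rw [norm_mul]
    exact mul_le_of_le_one_right (norm_nonneg _) (Real.abs_cos_le_one _)
  · exact Eventually.of_forall fun f => by fun_prop

theorem update_mem_paramSet {θ : Fin p → ℝ} (hθ : θ ∈ paramSet p a b) (i : Fin p) {r : ℝ}
    (hr : r ∈ Set.Icc a b) : Function.update θ i r ∈ paramSet p a b := fun j => by
  rcases eq_or_ne j i with rfl | h
  · rwa [Function.update_self]
  · rw [Function.update_of_ne h]; exact hθ j

/-- `K_θ` is continuous as a cosine transform of an integrable function; each further derivative is
a pointwise limit of difference quotients measurable in `t`. -/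
theorem ModelCondition.measurable_iterPartial (hab : a < b) (hK : ModelCondition a b K)
    (I : List (Fin p)) (hI : I.length ≤ 3) :
    ∀ θ ∈ paramSet p a b, Measurable fun t => iterPartial a b I (fun θ' => K θ' t) θ := by
  induction I with
  | nil =>
    intro θ hθ
    have : (fun t => iterPartial a b [] (fun θ' => K θ' t) θ)
        = cosTransform fun f => (fourierHat (K θ) f).re := by
      funext t
      exact hK.eq_cosTransform hθ t
    rw [this]
    exact (continuous_cosTransform (hK.integrable_hat θ hθ).re).measurable
  | cons i I ih =>
    intro θ hθ
    have hI2 : I.length ≤ 2 := by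
      rw [List.length_cons] at hI; omega
    have ih' := ih (by omega)
    have hne : (𝓝[Set.Icc a b \ {θ i}] (θ i)).NeBot :=
      accPt_principal_iff_nhdsWithin.1
        (uniqueDiffWithinAt_iff_accPt.1 (uniqueDiffOn_Icc hab (θ i) (hθ i)))
    classical
    refine measurable_of_tendsto_metrizable' (𝓝[Set.Icc a b \ {θ i}] (θ i))
      -- The value 0 is a filler off `[a, b]`, where the induction hypothesis says nothing; the
      -- filter does not see it.
      (f := fun r t => if r ∈ Set.Icc a b then
        slope (fun s => iterPartial a b I (fun θ' => K θ' t) (Function.update θ i s)) (θ i) r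
        else 0) (fun r => ?_) (tendsto_pi_nhds.2 fun t => ?_)
    · by_cases hr : r ∈ Set.Icc a b
      · simp only [if_pos hr, slope_def_field]
        exact ((ih' _ (update_mem_paramSet hθ i hr)).sub
          (ih' _ (update_mem_paramSet hθ i (hθ i)))).div_const _
      · simp only [if_neg hr]
        exact measurable_const
    · have hdiff : DifferentiableWithinAt ℝ
          (fun s => iterPartial a b I (fun θ' => K θ' t) (Function.update θ i s))
          (Set.Icc a b) (θ i) := by
        have h1 := hK.differentiable I hI2 t (Function.update θ i (θ i))
          (update_mem_paramSet hθ i (hθ i))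
        exact h1.comp (θ i) (hasDerivAt_update θ i (θ i)).differentiableAt.differentiableWithinAt
          fun s hs => update_mem_paramSet hθ i hs
      have h2 := hasDerivWithinAt_iff_tendsto_slope.1 hdiff.hasDerivWithinAt
      refine h2.congr' ?_
      filter_upwards [self_mem_nhdsWithin] with r hr
      rw [if_pos hr.1]

theorem ModelCondition.measurable_covTrace (hab : a < b) (hK : ModelCondition a b K)
    {θ : Fin p → ℝ} (hθ : θ ∈ paramSet p a b) (ε : ℝ) (w : List (FactorLabel p)) {ι : Type}
    [Fintype ι] [DecidableEq ι] (u : ι → Fin d → ℤ) :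
    Measurable fun x : ι → EuclideanSpace ℝ (Fin d) => covTrace a b K ε θ w u x := by
  refine measurable_trace_wordEval (fun I hI i j => ?_) w
  refine (hK.measurable_iterPartial hab I hI θ hθ).comp ?_
  unfold gridPoint
  fun_prop

end CovarianceMeasurability

/-! ### The law of large numbers for blocks. -/

section BlockLaw

variable {Ω : Type*} [MeasurableSpace Ω] {P : Measure Ω} [IsProbabilityMeasure P]
  {E : Type*} [MeasurableSpace E] {μ : Measure E} {X : ℕ → Ω → E}

theorem map_tuple_eq_pi (hX : ∀ i, Measurable (X i)) (hlaw : ∀ i, P.map (X i) = μ)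
    (hind : iIndepFun X P) {Λ : Type} [Fintype Λ] {f : Λ → ℕ} (hf : Function.Injective f) :
    P.map (fun ω l => X (f l) ω) = Measure.pi fun _ : Λ => μ := by
  have h := (iIndepFun_iff_map_fun_eq_pi_map fun l => (hX (f l)).aemeasurable).1 (hind.precomp hf)
  rw [h]
  simp only [hlaw]

/-- The strong law of large numbers for a function of disjoint blocks of an i.i.d. sequence. -/
theorem ae_tendsto_block_average (hX : ∀ i, Measurable (X i)) (hlaw : ∀ i, P.map (X i) = μ)
    (hind : iIndepFun X P) {Λ : Type} [Fintype Λ] {f : ℕ → Λ → ℕ}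
    (hf : ∀ m m' l l', f m l = f m' l' → m = m' ∧ l = l') {φ : (Λ → E) → ℝ} (hφ : Measurable φ)
    (hint : Integrable (fun ω => φ fun l => X (f 0 l) ω) P) :
    ∀ᵐ ω ∂P, Tendsto (fun n : ℕ => (∑ m ∈ Finset.range n, φ fun l => X (f m l) ω) / n) atTop
      (𝓝 (∫ y, φ y ∂Measure.pi fun _ : Λ => μ)) := by
  have hinj : ∀ m, Function.Injective (f m) := fun m l l' h => (hf m m l l' h).2
  have hmeas : ∀ m, Measurable fun ω => fun l => X (f m l) ω := fun m =>
    measurable_pi_lambda _ fun l => hX _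
  have hmap : ∀ m, P.map (fun ω l => X (f m l) ω) = Measure.pi fun _ : Λ => μ := fun m =>
    map_tuple_eq_pi hX hlaw hind (hinj m)
  have hmean : ∫ y, φ y ∂(Measure.pi fun _ : Λ => μ) = ∫ ω, φ (fun l => X (f 0 l) ω) ∂P := by
    rw [← hmap 0, integral_map (hmeas 0).aemeasurable hφ.aestronglyMeasurable]
  rw [hmean]
  refine strong_law_ae_real (fun m ω => φ fun l => X (f m l) ω) hint (fun m m' hmm => ?_)
    fun m => ?_
  · classical
    have hdisj : Disjoint (Finset.univ.image (f m)) (Finset.univ.image (f m')) := by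
      rw [Finset.disjoint_left]
      intro i hi hi'
      obtain ⟨l, -, hl⟩ := Finset.mem_image.1 hi
      obtain ⟨l', -, hl'⟩ := Finset.mem_image.1 hi'
      exact hmm (hf m m' l l' (hl.trans hl'.symm)).1
    have h := hind.indepFun_finset _ _ hdisj hX
    have hψ : ∀ m, Measurable fun z : (Finset.univ.image (f m) : Finset ℕ) → E =>
        φ fun l => z ⟨f m l, Finset.mem_image_of_mem _ (Finset.mem_univ l)⟩ := fun m =>
      hφ.comp (measurable_pi_lambda _ fun l => measurable_pi_apply _)
    exact h.comp (hψ m) (hψ m')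
  · exact (IdentDistrib.mk (hmeas m).aemeasurable (hmeas 0).aemeasurable
      ((hmap m).trans (hmap 0).symm)).comp hφ

end BlockLaw

/-! ### Passing to the limit. -/

section Limits

/-- If `s` is asymptotically within `ρ L` of `M L` for every `L` and `ρ → 0`, then `s` and `M`
have a common limit. -/
theorem tendsto_limUnder_of_eventually_abs_sub_le {s M ρ : ℕ → ℝ} (hρ : Tendsto ρ atTop (𝓝 0))
    (h : ∀ L : ℕ, 0 < L → ∀ η : ℝ, 0 < η → ∀ᶠ n in atTop, |s n - M L| ≤ ρ L + η) :
    Tendsto s atTop (𝓝 (limUnder atTop M)) := by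
  have hcauchy : CauchySeq M := by
    refine Metric.cauchySeq_iff'.2 fun δ hδ => ?_
    obtain ⟨N, hN⟩ := eventually_atTop.1
      ((hρ.eventually (gt_mem_nhds (by positivity : 0 < δ / 4))).and (eventually_gt_atTop 0))
    refine ⟨N, fun L hL => ?_⟩
    -- One large `n` serves both sides: `|M L - M N| ≤ ρ L + ρ N + δ / 4 < δ`.
    obtain ⟨n, h1, h2⟩ := ((h L (hN L hL).2 (δ / 8) (by positivity)).and
      (h N (hN N le_rfl).2 (δ / 8) (by positivity))).exists
    rw [Real.dist_eq]
    have h3 := (hN L hL).1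
    have h4 := (hN N le_rfl).1
    rw [abs_le] at h1 h2
    rw [abs_lt]
    constructor <;> linarith [h1.1, h1.2, h2.1, h2.2]
  have hlim := hcauchy.tendsto_limUnder
  refine Metric.tendsto_nhds.2 fun δ hδ => ?_
  obtain ⟨L, h1, h2, h3⟩ := ((hρ.eventually (gt_mem_nhds (by positivity : 0 < δ / 4))).and
    ((Metric.tendsto_nhds.1 hlim (δ / 4) (by positivity)).and (eventually_gt_atTop 0))).exists
  filter_upwards [h L h3 (δ / 4) (by positivity)] with n hn
  rw [Real.dist_eq] at h2 ⊢
  rw [abs_le] at hn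
  rw [abs_lt] at h2 ⊢
  constructor <;> linarith [hn.1, hn.2, h2.1, h2.2]

variable {Ω : Type*} [MeasurableSpace Ω] {P : Measure Ω} [IsProbabilityMeasure P]

/-- Dominated convergence for `(Y n - S) ^ 2`; the variance is at most the second moment about `S`.
-/
theorem tendsto_eLpNorm_and_variance_of_ae_bounded {Y : ℕ → Ω → ℝ} {S C : ℝ}
    (hY : ∀ n, Measurable (Y n)) (hC : ∀ᵐ ω ∂P, ∀ n, |Y n ω| ≤ C)
    (hS : ∀ᵐ ω ∂P, Tendsto (fun n => Y n ω) atTop (𝓝 S)) :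
    (∀ n, MemLp (Y n) 2 P) ∧ Tendsto (fun n => eLpNorm (fun ω => Y n ω - S) 2 P) atTop (𝓝 0) ∧
      Tendsto (fun n => variance (Y n) P) atTop (𝓝 0) := by
  have hmem : ∀ n, MemLp (Y n) 2 P := fun n =>
    MemLp.of_bound (hY n).aestronglyMeasurable C (hC.mono fun ω h => h n)
  have hmem' : ∀ n, MemLp (fun ω => Y n ω - S) 2 P := fun n => (hmem n).sub (memLp_const S)
  have hint : Tendsto (fun n => ∫ ω, (Y n ω - S) ^ 2 ∂P) atTop (𝓝 0) := by
    have h := tendsto_integral_of_dominated_convergence (μ := P)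
      (F := fun n ω => (Y n ω - S) ^ 2) (f := fun _ => 0) (fun _ => (C + |S|) ^ 2)
      (fun n => (((hY n).sub_const S).pow_const 2).aestronglyMeasurable) (integrable_const _)
      (fun n => by
        filter_upwards [hC] with ω hω
        rw [Real.norm_of_nonneg (sq_nonneg _), ← sq_abs (Y n ω - S)]
        exact pow_le_pow_left₀ (abs_nonneg _)
          ((abs_sub _ _).trans (add_le_add_left (hω n) _)) 2)
      (by
        filter_upwards [hS] with ω hω
        simpa using (hω.sub_const S).pow 2)
    simpa using h
  refine ⟨hmem, ?_, ?_⟩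
  · have h : ∀ n, eLpNorm (fun ω => Y n ω - S) 2 P
        = ENNReal.ofReal ((∫ ω, (Y n ω - S) ^ 2 ∂P) ^ (2 : ℝ)⁻¹) := fun n => by
      rw [(hmem' n).eLpNorm_eq_integral_rpow_norm two_ne_zero ENNReal.ofNat_ne_top]
      simp
    simp only [h]
    have h2 := (hint.rpow_const (p := (2 : ℝ)⁻¹) (Or.inr (by positivity)))
    rw [Real.zero_rpow (by norm_num)] at h2
    simpa using ENNReal.tendsto_ofReal h2
  · refine squeeze_zero (fun n => variance_nonneg _ _) (fun n => ?_) hint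
    rw [← variance_sub_const (hY n).aestronglyMeasurable S]
    exact variance_le_expectation_sq ((hY n).sub_const S).aestronglyMeasurable

end Limits

/-! ### Convergence of the normalized trace. -/

section NormalizedTrace

variable {d p : ℕ} {a b : ℝ} {K : (Fin p → ℝ) → EuclideanSpace ℝ (Fin d) → ℝ}
  {Ω : Type*} [MeasurableSpace Ω] {P : Measure Ω} [IsProbabilityMeasure P]
  {μ : Measure (EuclideanSpace ℝ (Fin d))} {X : ℕ → Ω → EuclideanSpace ℝ (Fin d)}

/-- The mean normalized trace for the box `{0, ..., L - 1}^d`. -/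
def meanBlockTrace (a b : ℝ) (K : (Fin p → ℝ) → EuclideanSpace ℝ (Fin d) → ℝ)
    (μ : Measure (EuclideanSpace ℝ (Fin d))) (ε : ℝ) (θ : Fin p → ℝ) (w : List (FactorLabel p))
    (L : ℕ) : ℝ :=
  (∫ y, blockTrace a b K ε θ w L y ∂Measure.pi fun _ : Fin d → Fin L => μ) / (L : ℝ) ^ d

theorem normTrace_eq_covTrace {n : ℕ} (v : ℕ → Fin d → ℕ) (ε : ℝ)
    (x : Fin n → EuclideanSpace ℝ (Fin d)) (θ : Fin p → ℝ) (w : List (FactorLabel p)) :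
    normTrace a b K v ε x θ w
      = covTrace a b K ε θ w (fun i : Fin n => intGrid v i) x / n := by
  rw [normTrace, wordMatrix_eq_wordEval, covTrace, one_div, inv_mul_eq_div]

theorem ae_forall_abs_apply_le (hμ : IsPerturbationLaw μ) (hX : ∀ i, Measurable (X i))
    (hlaw : ∀ i, P.map (X i) = μ) : ∀ᵐ ω ∂P, ∀ i k, |X i ω k| ≤ 1 := by
  rw [ae_all_iff]
  intro i
  have h1 : ∀ᵐ x ∂(P.map (X i)), x ∈ μ.support := by
    rw [hlaw i]; exact Measure.support_mem_ae
  filter_upwards [ae_of_ae_map (hX i).aemeasurable h1] with ω hω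
  exact hμ.support_subset _ hω

theorem blockIndex_injective {L : ℕ} (e : (Fin d → ℕ) ≃ ℕ) (m m' : ℕ)
    (l l' : Fin d → Fin L)
    (h : e (fun i => L * e.symm m i + l i) = e fun i => L * e.symm m' i + l' i) :
    m = m' ∧ l = l' := by
  have h1 := e.injective h
  have key : ∀ i, e.symm m i = e.symm m' i ∧ l i = l' i := fun i => by
    have h2 := congrFun h1 i
    have hL : 0 < L := Fin.pos (l i)
    have h3 := congrArg (· / L) h2
    have h4 := congrArg (· % L) h2
    simp only [Nat.mul_add_div hL, Nat.div_eq_of_lt (l i).2, Nat.div_eq_of_lt (l' i).2,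
      Nat.mul_add_mod, Nat.mod_eq_of_lt (l i).2, Nat.mod_eq_of_lt (l' i).2, add_zero] at h3 h4
    exact ⟨h3, Fin.ext h4⟩
  exact ⟨e.symm.injective (funext fun i => (key i).1), funext fun i => (key i).2⟩

/-- On one event of full probability the perturbations lie in the cube and the strong law holds for
all block sizes `L`, which are countably many; the rest is deterministic. The limit is built from
`μ` alone, not from `v` or `X`. -/
theorem ae_tendsto_normTrace (hd : 1 ≤ d) (hab : a < b) (hK : ModelCondition a b K)
    (hμ : IsPerturbationLaw μ) {ε : ℝ} (hε : ε ∈ Set.Ico (0 : ℝ) (1 / 2)) {θ : Fin p → ℝ}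
    (hθ : θ ∈ paramSet p a b) (w : List (FactorLabel p)) {v : ℕ → Fin d → ℕ}
    (hv : IsGridSequence v) (hX : ∀ i, Measurable (X i)) (hlaw : ∀ i, P.map (X i) = μ)
    (hind : iIndepFun X P) :
    ∀ᵐ ω ∂P, Tendsto (fun n : ℕ => normTrace a b K v ε (fun i : Fin n => X i ω) θ w) atTop
      (𝓝 (limUnder atTop (meanBlockTrace a b K μ ε θ w))) := by
  have hs : 0 < 1 - 2 * ε := by linarith [hε.2]
  obtain ⟨e, hve, he⟩ := hv.exists_equiv hd
  obtain ⟨B, hB, hsub⟩ := hK.exists_abs_covTrace_sub_le hε w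
  obtain ⟨D, hD, hblock⟩ := hK.exists_abs_covTrace_sub_sum_blockTrace_le hε w
  obtain ⟨A, hA, hbd⟩ := hK.exists_abs_covTrace_le hε w
  have hcube := ae_forall_abs_apply_le hμ hX hlaw
  have hu := intGrid_injective (hv.injective hd)
  have hmeas : ∀ L, Measurable (blockTrace a b K ε θ w L) := fun L =>
    hK.measurable_covTrace hab hθ ε w _
  have hLLN : ∀ L : ℕ, ∀ᵐ ω ∂P, Tendsto (fun n : ℕ => (∑ m ∈ Finset.range n,
      blockTrace a b K ε θ w L fun l => X (e fun i => L * e.symm m i + l i) ω) / n) atTop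
      (𝓝 (∫ y, blockTrace a b K ε θ w L y ∂Measure.pi fun _ : Fin d → Fin L => μ)) := fun L => by
    refine ae_tendsto_block_average hX hlaw hind
      (f := fun m (l : Fin d → Fin L) => e fun i => L * e.symm m i + l i)
      (blockIndex_injective e) (hmeas L) ?_
    refine Integrable.of_bound ((hmeas L).comp (measurable_pi_lambda _ fun l =>
      hX _)).aestronglyMeasurable (A * Fintype.card (Fin d → Fin L)) ?_
    filter_upwards [hcube] with ω hω
    refine hbd θ hθ _ _ (fun l l' h => ?_) fun l => hω _
    funext k
    exact Fin.ext (Int.ofNat.inj (congrFun h k))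
  filter_upwards [hcube, ae_all_iff.2 hLLN] with ω hω hlln
  refine tendsto_limUnder_of_eventually_abs_sub_le
    (ρ := fun L => D * boundaryLoss d (1 - 2 * ε) L)
    (by simpa using (tendsto_boundaryLoss (d := d) hs).const_mul D) fun L hL η hη => ?_
  simp only [normTrace_eq_covTrace]
  have hL' : (0 : ℝ) < L := by exact_mod_cast hL
  refine eventually_abs_div_sub_le hd
    (T := fun n => covTrace a b K ε θ w (fun i : Fin n => intGrid v i) fun i => X i ω)
    (hsub θ hθ (intGrid v) (fun i => X i ω) hu hω) hL ?_
    (fun k => hblock θ hθ v e hv hve he (fun i => X i ω) hω k L hL) ?_ hη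
  · refine mul_nonneg hD (tsum_nonneg fun w => ?_)
    exact mul_nonneg (decayProfile_pos hs w).le (by positivity)
  · have hpow : Tendsto (fun k : ℕ => k ^ d) atTop atTop :=
      tendsto_pow_atTop (Nat.pos_iff_ne_zero.1 hd)
    -- The strong law along the subsequence of `k ^ d` blocks, normalized per point.
    have h1 := ((hlln L).comp hpow).div_const ((L : ℝ) ^ d)
    refine h1.congr fun k => ?_
    simp only [Function.comp_apply]
    push_cast
    rw [mul_pow, div_div]

theorem normTrace_limits (hd : 1 ≤ d) (hab : a < b) (hK : ModelCondition a b K)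
    (hμ : IsPerturbationLaw μ) {ε : ℝ} (hε : ε ∈ Set.Ico (0 : ℝ) (1 / 2)) {θ : Fin p → ℝ}
    (hθ : θ ∈ paramSet p a b) (w : List (FactorLabel p)) {v : ℕ → Fin d → ℕ}
    (hv : IsGridSequence v) (hX : ∀ i, Measurable (X i)) (hlaw : ∀ i, P.map (X i) = μ)
    (hind : iIndepFun X P) :
    (∀ n : ℕ, MemLp (fun ω => normTrace a b K v ε (fun i : Fin n => X i ω) θ w) 2 P) ∧
      Tendsto (fun n : ℕ => eLpNorm (fun ω => normTrace a b K v ε (fun i : Fin n => X i ω) θ w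
        - limUnder atTop (meanBlockTrace a b K μ ε θ w)) 2 P) atTop (𝓝 0) ∧
      Tendsto (fun n : ℕ => variance
        (fun ω => normTrace a b K v ε (fun i : Fin n => X i ω) θ w) P) atTop (𝓝 0) := by
  obtain ⟨A, hA, hbd⟩ := hK.exists_abs_covTrace_le hε w
  have hu := intGrid_injective (hv.injective hd)
  refine tendsto_eLpNorm_and_variance_of_ae_bounded (C := A) (fun n => ?_) ?_
    (ae_tendsto_normTrace hd hab hK hμ hε hθ w hv hX hlaw hind)
  · simp only [normTrace_eq_covTrace]
    exact ((hK.measurable_covTrace hab hθ ε w _).comp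
      (measurable_pi_lambda _ fun i => hX _)).div_const _
  · filter_upwards [ae_forall_abs_apply_le hμ hX hlaw] with ω hω n
    rw [normTrace_eq_covTrace, abs_div, Nat.abs_cast]
    -- This form also covers `n = 0`, where the quotient is 0.
    refine div_le_of_le_mul₀ (by positivity) hA ?_
    have := hbd θ hθ (fun i : Fin n => intGrid v i) (fun i => X i ω)
      (hu.comp Fin.val_injective) fun i => hω i
    rwa [Fintype.card_fin] at this

end NormalizedTrace

end PerturbedGrid

end

theorem mainTheorem12 {d p : ℕ} (hd : 1 ≤ d) (a b : ℝ) (hab : a < b)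
    (K : (Fin p → ℝ) → EuclideanSpace ℝ (Fin d) → ℝ)
    (hK : PerturbedGrid.ModelCondition a b K)
    (μ : Measure (EuclideanSpace ℝ (Fin d))) (hμ : PerturbedGrid.IsPerturbationLaw μ) :
    (∀ v : ℕ → Fin d → ℕ, PerturbedGrid.IsGridSequence v →
      ∀ ε ∈ Set.Ico (0 : ℝ) (1 / 2), ∀ w : List (PerturbedGrid.FactorLabel p),
        ∃ C : ℝ, ∀ θ ∈ PerturbedGrid.paramSet p a b,
          PerturbedGrid.MemClass a b K v ε μ.support θ w →
          ∀ (n : ℕ) (x : Fin n → EuclideanSpace ℝ (Fin d)), (∀ i, x i ∈ μ.support) →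
            ∀ j : ℕ, (Matrix.toEuclideanLin
              (PerturbedGrid.wordMatrix a b K v ε x θ w)).singularValues j ≤ C) ∧
    (∃ S : ℝ → (Fin p → ℝ) → List (PerturbedGrid.FactorLabel p) → ℝ,
      ∀ ε ∈ Set.Ico (0 : ℝ) (1 / 2), ∀ θ ∈ PerturbedGrid.paramSet p a b,
      ∀ w : List (PerturbedGrid.FactorLabel p),
      ∀ v : ℕ → Fin d → ℕ, PerturbedGrid.IsGridSequence v →
      PerturbedGrid.MemClass a b K v ε μ.support θ w →
      ∀ (Ω : Type*) [MeasurableSpace Ω] (P : Measure Ω) [IsProbabilityMeasure P]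
        (X : ℕ → Ω → EuclideanSpace ℝ (Fin d)),
        (∀ i, Measurable (X i)) → (∀ i, P.map (X i) = μ) → iIndepFun X P →
        (∀ᵐ ω ∂P, Tendsto
          (fun n : ℕ => PerturbedGrid.normTrace a b K v ε (fun i : Fin n => X i ω) θ w)
          atTop (𝓝 (S ε θ w))) ∧
        (∀ n : ℕ, MemLp
          (fun ω => PerturbedGrid.normTrace a b K v ε (fun i : Fin n => X i ω) θ w) 2 P) ∧
        Tendsto (fun n : ℕ => eLpNorm
          (fun ω => PerturbedGrid.normTrace a b K v ε (fun i : Fin n => X i ω) θ w - S ε θ w)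
          2 P) atTop (𝓝 0) ∧
        Tendsto (fun n : ℕ => variance
          (fun ω => PerturbedGrid.normTrace a b K v ε (fun i : Fin n => X i ω) θ w) P)
          atTop (𝓝 0)) := by
  refine ⟨fun v hv ε hε w => ?_, fun ε θ w =>
    limUnder atTop (PerturbedGrid.meanBlockTrace a b K μ ε θ w), ?_⟩
  · obtain ⟨C, hC⟩ := PerturbedGrid.exists_singularValues_le hd hK hμ.support_subset hv hε w
    exact ⟨C, fun θ hθ _ n x hx j => hC θ hθ n x hx j⟩
  · intro ε hε θ hθ w v hv _ Ω _ P _ X hX hlaw hind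
    exact ⟨PerturbedGrid.ae_tendsto_normTrace hd hab hK hμ hε hθ w hv hX hlaw hind,
      PerturbedGrid.normTrace_limits hd hab hK hμ hε hθ w hv hX hlaw hind⟩
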